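/- All graphs are finite and simple. For a family $\mathcal H$ of graphs, a graph $G$ is $\mathcal H$-saturated if $G$ contains no (not necessarily induced) subgraph isomorphic to a member of $\mathcal H$, but for every pair of distinct non-adjacent vertices $u,v$ of $G$ the graph $G+uv$ contains a subgraph isomorphic to some member of $\mathcal H$. Let $\mathrm{sat}(n,\mathcal H)$ be the minimum number of edges of an $\mathcal H$-saturated graph on $n$ vertices, and let $2\mathcal C_{\ge 3}$ be the family of all vertex-disjoint unions $C_a\cup C_b$ of two cycles with $a,b\ge 3$ (possibly $a=b$). Theorem. For every integer $n\ge 6$, $2\mathcal C_{\ge 3}$-saturated graphs on $n$ vertices exist, and $$\mathrm{sat}(n,2\mathcal C_{\ge 3})=\begin{cases}10, & n=6,\\ n+5, & n\ge 7.\end{cases}$$ Moreover, for $n=6$ the wheel $W_6=K_1\vee C_5$ (one vertex joined to all the vertices of a cycle on five vertices) is, up to isomorphism, the only extremal graph: a graph on $6$ vertices is $2\mathcal C_{\ge 3}$-saturated with exactly $\mathrm{sat}(6,2\mathcal C_{\ge 3})=10$ edges if and only if it is isomorphic to $W_6$. -/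

import Mathlib

open SimpleGraph

/-- A graph `G` is saturated with respect to the family `(H i)`: it contains no copy of any member
(as a not necessarily induced subgraph), but adding any missing edge creates a copy of a member. -/
def IsSaturated {ι : Type} {W : ι → Type} (H : ∀ i, SimpleGraph (W i))
    {V : Type} (G : SimpleGraph V) : Prop :=
  (∀ i, (H i).Free G) ∧
    ∀ u v : V, u ≠ v → ¬ G.Adj u v → ∃ i, (H i).IsContained (G ⊔ edge u v)

/-- The set of all sizes (numbers of edges) of `n`-vertex saturated graphs. -/
def saturationSpectrum (n : ℕ) {ι : Type} {W : ι → Type} (H : ∀ i, SimpleGraph (W i)) : Set ℕ :=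
  {m | ∃ G : SimpleGraph (Fin n), IsSaturated H G ∧ G.edgeSet.ncard = m}

/-- The saturation number: the minimum size of an `n`-vertex saturated graph
(a genuine minimum whenever `saturationSpectrum n H` is nonempty). -/
noncomputable def satNumber (n : ℕ) {ι : Type} {W : ι → Type} (H : ∀ i, SimpleGraph (W i)) : ℕ :=
  sInf (saturationSpectrum n H)

/-- The family of vertex-disjoint unions of two cycles `C_a` and `C_b`, with `a, b ≥ 3`. -/
def twoDisjointCycles (l : {l : ℕ × ℕ // 3 ≤ l.1 ∧ 3 ≤ l.2}) :
    SimpleGraph (Fin l.1.1 ⊕ Fin l.1.2) :=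
  cycleGraph l.1.1 ⊕g cycleGraph l.1.2

/-- The wheel on `n` vertices: the join of a single vertex and a cycle on `n - 1` vertices
(used for `n ≥ 5`). -/
def wheelGraph (n : ℕ) : SimpleGraph (Fin 1 ⊕ Fin (n - 1)) :=
  (emptyGraph (Fin 1) ⊕g cycleGraph (n - 1)) ⊔ completeBipartiteGraph (Fin 1) (Fin (n - 1))

/-! Cycles are replaced by cores: a set inducing minimum degree at least two contains a cycle, and
the vertex set of a cycle is a core. Two disjoint cores behave well when vertices are deleted or
suppressed. Saturation is stated on a finite set `W` inside a fixed type (`SatOn`), so a reduction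
only shrinks `W` and never changes the type.

The upper bound is `K₅` with all other vertices pendant at one of its vertices, and the wheel for `n
= 6`. The lower bound is an induction on `n` with the statement "at least `n + 5` edges, or at least
`n + 4` edges and a hub" (`HasHub`). Three reductions keep saturation and remove one vertex:
deleting a leaf or suppressing a degree-two vertex with non-adjacent neighbours (one edge lost), and
deleting one of two degree-two vertices on the same adjacent pair (two edges lost). The second
alternative is needed only for the wheel on six vertices; its hub rules out the first two
reductions, and the third gains a spare edge.

If no reduction applies (`ReducedOn`), each degree-two vertex is an ear, the tip of a triangle, and
distinct ears have distinct bases. With `k` ears and `e` edges, the degree sum gives `2e ≥ 3n - k`.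
For `k ≥ 1`, the complement of an ear's triangle is a forest, which gives `e ≥ 2n - k - 1`. Two
bases always meet, since otherwise there are two disjoint triangles; so for `k ≥ 2` they form a star
or the sides of a triangle. These counts leave only graphs with `n = 7` or `n = 8` to exclude, by
finer counting or by saturation.

For `n = 6` two disjoint cores are two triangles, so the graph consists of two triangles minus one
edge plus some of nine cross pairs: a finite check. -/

/-- A nonempty vertex set in which every vertex has at least two neighbours. -/
def IsCore {V : Type} (G : SimpleGraph V) (A : Finset V) : Prop :=
  A.Nonempty ∧ ∀ v ∈ A, ∃ a ∈ A, ∃ b ∈ A, a ≠ b ∧ G.Adj v a ∧ G.Adj v b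

/-- The graph has two disjoint cores, equivalently two disjoint cycles. -/
def HasTwoCores {V : Type} (G : SimpleGraph V) : Prop :=
  ∃ A B : Finset V, Disjoint A B ∧ IsCore G A ∧ IsCore G B

/-! ### Cores and disjoint cycles -/

section Bridge
variable {V : Type} {G : SimpleGraph V}

theorem IsCore.image_cycleGraph [DecidableEq V] {n : ℕ} (hn : 3 ≤ n) (f : Fin n → V)
    (hf : Function.Injective f) (hadj : ∀ i j, (cycleGraph n).Adj i j → G.Adj (f i) (f j)) :
    IsCore G (Finset.univ.image f) := by
  obtain ⟨m, rfl⟩ : ∃ m, n = m + 3 := ⟨n - 3, by omega⟩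
  refine ⟨⟨f 0, by simp⟩, fun v hv => ?_⟩
  obtain ⟨i, -, rfl⟩ := Finset.mem_image.1 hv
  refine ⟨f (i + 1), by simp, f (i - 1), by simp, fun h => ?_, hadj _ _ ?_, hadj _ _ ?_⟩
  -- Coinciding neighbours `i + 1` and `i - 1` would give `2 = 0` modulo a number that is at least
  -- three.
  · have h1 : (1 : Fin (m + 3)) + 1 = 0 := by
      have := hf h
      calc (1 : Fin (m + 3)) + 1 = (i + 1) - (i - 1) := by abel
        _ = 0 := by rw [this]; abel
    have h2 := congrArg Fin.val h1
    simp [Fin.val_add] at h2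
    rw [Nat.mod_eq_of_lt (by omega)] at h2
    omega
  · exact cycleGraph_adj.2 (Or.inr (by abel))
  · exact cycleGraph_adj.2 (Or.inl (by abel))

/-- In a forest, the component of a vertex of `A` would be a nontrivial tree and have a leaf, but
both neighbours provided by the core stay in the component. -/
theorem IsCore.not_isAcyclic {A : Finset V} (hA : IsCore G A) :
    ¬ (G.induce (A : Set V)).IsAcyclic := by
  classical
  intro hac
  obtain ⟨v, hv⟩ := hA.1
  let H := G.induce (A : Set V)
  let c := H.connectedComponentMk ⟨v, hv⟩
  have htree := hac.isTree_connectedComponent c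
  have key : ∀ w : c, ∃ a b : c, a ≠ b ∧ c.toSimpleGraph.Adj w a ∧ c.toSimpleGraph.Adj w b := by
    rintro ⟨⟨w, hw⟩, hwc⟩
    obtain ⟨a, ha, b, hb, hab, hwa, hwb⟩ := hA.2 w hw
    have hwa' : H.Adj ⟨w, hw⟩ ⟨a, ha⟩ := hwa
    have hwb' : H.Adj ⟨w, hw⟩ ⟨b, hb⟩ := hwb
    refine ⟨⟨⟨a, ha⟩, ?_⟩, ⟨⟨b, hb⟩, ?_⟩, ?_, hwa, hwb⟩
    · exact c.mem_supp_of_adj_mem_supp hwc hwa'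
    · exact c.mem_supp_of_adj_mem_supp hwc hwb'
    · simpa using hab
  have : Nontrivial c := by
    obtain ⟨a, b, hab, -⟩ := key ⟨⟨v, hv⟩, rfl⟩
    exact ⟨a, b, hab⟩
  obtain ⟨w, hw⟩ := htree.exists_vert_degree_one_of_nontrivial
  obtain ⟨a, b, hab, hwa, hwb⟩ := key w
  have : 1 < c.toSimpleGraph.degree w := by
    rw [← card_neighborFinset_eq_degree, Finset.one_lt_card]
    exact ⟨a, by simpa using hwa, b, by simpa using hwb, hab⟩
  omega

theorem IsCore.exists_cycleGraph {A : Finset V} (hA : IsCore G A) :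
    ∃ n, 3 ≤ n ∧ ∃ f : Fin n → V, Function.Injective f ∧ (∀ i, f i ∈ A) ∧
      ∀ i j, (cycleGraph n).Adj i j → G.Adj (f i) (f j) := by
  have h := hA.not_isAcyclic
  rw [isAcyclic_iff_free_cycleGraph] at h
  push Not at h
  obtain ⟨n, hn, h⟩ := h
  obtain ⟨f⟩ := h
  exact ⟨n, hn, fun i => (f i).1, Subtype.val_injective.comp f.injective, fun i => (f i).2,
    fun i j hij => f.toHom.map_adj hij⟩

theorem exists_isContained_twoDisjointCycles_iff :
    (∃ i, (twoDisjointCycles i).IsContained G) ↔ HasTwoCores G := by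
  classical
  constructor
  · rintro ⟨⟨⟨a, b⟩, ha, hb⟩, ⟨f⟩⟩
    have hinj := f.injective
    refine ⟨Finset.univ.image (fun i => f (Sum.inl i)), Finset.univ.image (fun i => f (Sum.inr i)),
      ?_, ?_, ?_⟩
    · rw [Finset.disjoint_left]
      intro v hv hv'
      obtain ⟨i, -, rfl⟩ := Finset.mem_image.1 hv
      obtain ⟨j, -, h⟩ := Finset.mem_image.1 hv'
      simpa using hinj h
    · refine IsCore.image_cycleGraph ha _ (hinj.comp Sum.inl_injective) fun i j h => ?_
      exact f.toHom.map_adj (by simpa [twoDisjointCycles] using h)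
    · refine IsCore.image_cycleGraph hb _ (hinj.comp Sum.inr_injective) fun i j h => ?_
      exact f.toHom.map_adj (by simpa [twoDisjointCycles] using h)
  · rintro ⟨A, B, hAB, hA, hB⟩
    obtain ⟨a, ha, f, hf, hfA, hfa⟩ := hA.exists_cycleGraph
    obtain ⟨b, hb, g, hg, hgB, hgb⟩ := hB.exists_cycleGraph
    refine ⟨⟨(a, b), ha, hb⟩, ⟨⟨⟨Sum.elim f g, ?_⟩, ?_⟩⟩⟩
    · rintro (i | i) (j | j) h
      · exact hfa _ _ (by simpa [twoDisjointCycles] using h)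
      · simp [twoDisjointCycles] at h
      · simp [twoDisjointCycles] at h
      · exact hgb _ _ (by simpa [twoDisjointCycles] using h)
    · refine Function.Injective.sumElim hf hg fun i j h => ?_
      exact Finset.disjoint_left.1 hAB (hfA i) (h ▸ hgB j)

theorem isSaturated_twoDisjointCycles_iff :
    IsSaturated twoDisjointCycles G ↔
      ¬ HasTwoCores G ∧ ∀ u v, u ≠ v → ¬ G.Adj u v → HasTwoCores (G ⊔ edge u v) := by
  unfold IsSaturated
  refine and_congr ?_ ?_
  · rw [← exists_isContained_twoDisjointCycles_iff, not_exists]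
  · simp only [exists_isContained_twoDisjointCycles_iff]

end Bridge

/-! ### Saturation on a vertex set, and elementary facts on cores -/

/-- `G` lives on the vertex set `W` and is saturated there for the family of two disjoint cycles. -/
structure SatOn {V : Type} (W : Finset V) (G : SimpleGraph V) : Prop where
  supp : ∀ u v, G.Adj u v → u ∈ W
  free : ¬ HasTwoCores G
  sat : ∀ u ∈ W, ∀ v ∈ W, u ≠ v → ¬ G.Adj u v → HasTwoCores (G ⊔ edge u v)

open Classical in
/-- The set of neighbours of a vertex. -/
noncomputable def nbrs {V : Type} [Fintype V] (G : SimpleGraph V) (v : V) : Finset V :=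
  Finset.univ.filter (G.Adj v)

open Classical in
/-- The set of edges. -/
noncomputable def edges {V : Type} [Fintype V] (G : SimpleGraph V) : Finset (Sym2 V) :=
  Finset.univ.filter (· ∈ G.edgeSet)

section Cores
variable {V : Type} {G H : SimpleGraph V} {A B W : Finset V} {u v w x y z : V}

theorem sup_edge_adj_iff :
    (G ⊔ edge u v).Adj x y ↔ G.Adj x y ∨ (x ≠ y ∧ (x = u ∧ y = v ∨ x = v ∧ y = u)) := by
  rw [sup_adj, edge_adj]
  tauto

theorem IsCore.mono (h : IsCore G A) (hGH : ∀ x ∈ A, ∀ y ∈ A, G.Adj x y → H.Adj x y) :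
    IsCore H A := by
  refine ⟨h.1, fun v hv => ?_⟩
  obtain ⟨a, ha, b, hb, hab, h1, h2⟩ := h.2 v hv
  exact ⟨a, ha, b, hb, hab, hGH _ hv _ ha h1, hGH _ hv _ hb h2⟩

theorem IsCore.of_sup_edge (h : IsCore (G ⊔ edge u v) A) (huv : u ∉ A ∨ v ∉ A) : IsCore G A := by
  refine h.mono fun x hx y hy hxy => ?_
  rw [sup_edge_adj_iff] at hxy
  grind

theorem IsCore.sup_edge (h : IsCore G A) : IsCore (G ⊔ edge u v) A :=
  h.mono fun _ _ _ _ hxy => Or.inl hxy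

theorem isCore_triangle [DecidableEq V] (hxy : G.Adj x y) (hyz : G.Adj y z) (hxz : G.Adj x z) :
    IsCore G {x, y, z} := by
  have := hxy.ne
  have := hyz.ne
  have := hxz.ne
  refine ⟨⟨x, by simp⟩, fun w hw => ?_⟩
  simp only [Finset.mem_insert, Finset.mem_singleton] at hw
  rcases hw with rfl | rfl | rfl
  · exact ⟨y, by simp, z, by simp, by assumption, hxy, hxz⟩
  · exact ⟨x, by simp, z, by simp, by assumption, hxy.symm, hyz⟩
  · exact ⟨x, by simp, y, by simp, by assumption, hxz.symm, hyz.symm⟩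

theorem IsCore.three_le_card (h : IsCore G A) : 3 ≤ A.card := by
  classical
  obtain ⟨v, hv⟩ := h.1
  obtain ⟨a, ha, b, hb, hab, h1, h2⟩ := h.2 v hv
  have h3 : ({v, a, b} : Finset V) ⊆ A := by
    intro t ht
    simp only [Finset.mem_insert, Finset.mem_singleton] at ht
    rcases ht with rfl | rfl | rfl <;> assumption
  calc 3 = ({v, a, b} : Finset V).card :=
        (Finset.card_eq_three.2 ⟨v, a, b, h1.ne, h2.ne, hab, rfl⟩).symm
    _ ≤ _ := Finset.card_le_card h3

theorem IsCore.not_subset_pair [DecidableEq V] (h : IsCore G A) : ¬ A ⊆ {u, v} := fun hs =>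
  absurd (h.three_le_card.trans ((Finset.card_le_card hs).trans Finset.card_le_two)) (by norm_num)

theorem not_triangles (hG : ¬ HasTwoCores G) {a b c : V} (hxy : G.Adj x y) (hyz : G.Adj y z)
    (hxz : G.Adj x z) (hab : G.Adj a b) (hbc : G.Adj b c) (hac : G.Adj a c)
    (h1 : x ≠ a) (h2 : x ≠ b) (h3 : x ≠ c) (h4 : y ≠ a) (h5 : y ≠ b) (h6 : y ≠ c)
    (h7 : z ≠ a) (h8 : z ≠ b) (h9 : z ≠ c) : False := by
  classical
  refine hG ⟨{x, y, z}, {a, b, c}, ?_, isCore_triangle hxy hyz hxz, isCore_triangle hab hbc hac⟩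
  rw [Finset.disjoint_left]
  grind

namespace SatOn

theorem mem_left (h : SatOn W G) (ha : G.Adj u v) : u ∈ W := h.supp _ _ ha

theorem mem_right (h : SatOn W G) (ha : G.Adj u v) : v ∈ W := h.supp _ _ ha.symm

theorem core_subset (h : SatOn W G) (hA : IsCore G A) : A ⊆ W := fun v hv => by
  obtain ⟨a, -, -, -, -, h1, -⟩ := hA.2 v hv
  exact h.mem_left h1

theorem core_subset' (h : SatOn W G) (hu : u ∈ W) (hv : v ∈ W) (hA : IsCore (G ⊔ edge u v) A) :
    A ⊆ W := fun w hw => by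
  obtain ⟨a, -, -, -, -, h1, -⟩ := hA.2 w hw
  rw [sup_edge_adj_iff] at h1
  rcases h1 with h1 | ⟨-, ⟨rfl, -⟩ | ⟨rfl, -⟩⟩
  · exact h.mem_left h1
  · exact hu
  · exact hv

/-- The two cores of `G + uv` are not both cores of `G`, so one of them contains both `u` and `v`;
the other misses them and is a core of `G`. All later uses of saturation go through this form. -/
theorem exists_cores (h : SatOn W G) (hu : u ∈ W) (hv : v ∈ W) (huv : u ≠ v) (ha : ¬ G.Adj u v) :
    ∃ A B, Disjoint A B ∧ u ∈ A ∧ v ∈ A ∧ IsCore (G ⊔ edge u v) A ∧ IsCore G B ∧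
      A ⊆ W ∧ B ⊆ W := by
  obtain ⟨A, B, hAB, hA, hB⟩ := h.sat u hu v hv huv ha
  by_cases h1 : u ∈ A ∧ v ∈ A
  · have h2 : IsCore G B := hB.of_sup_edge (Or.inl (Finset.disjoint_left.1 hAB h1.1))
    exact ⟨A, B, hAB, h1.1, h1.2, hA, h2, h.core_subset' hu hv hA, h.core_subset h2⟩
  · have h1 : IsCore G A := hA.of_sup_edge (by tauto)
    by_cases h2 : u ∈ B ∧ v ∈ B
    · exact ⟨B, A, hAB.symm, h2.1, h2.2, hB, h1, h.core_subset' hu hv hB, h.core_subset h1⟩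
    · exact absurd ⟨A, B, hAB, h1, hB.of_sup_edge (by tauto)⟩ h.free

end SatOn
end Cores

/-! ### Degree sums and edge counts -/

section Counting
variable {V : Type} [Fintype V] {G : SimpleGraph V} {A F W : Finset V} {u v w x y z : V}

@[simp] theorem mem_nbrs : w ∈ nbrs G v ↔ G.Adj v w := by simp [nbrs]

@[simp] theorem mem_edges {e : Sym2 V} : e ∈ edges G ↔ e ∈ G.edgeSet := by simp [edges]

theorem card_edges_eq_ncard : (edges G).card = G.edgeSet.ncard := by
  rw [← Set.ncard_coe_finset]
  congr 1
  ext e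
  simp

theorem sum_card_nbrs : ∑ v, (nbrs G v).card = 2 * (edges G).card := by
  classical
  have h := G.sum_degrees_eq_twice_card_edges
  have h1 : G.edgeFinset = edges G := by ext e; simp
  rw [h1] at h
  rw [← h]
  refine Finset.sum_congr rfl fun v _ => ?_
  rw [← card_neighborFinset_eq_degree]
  congr 1
  ext w
  simp

theorem SatOn.sum_card_nbrs (h : SatOn W G) : ∑ v ∈ W, (nbrs G v).card = 2 * (edges G).card := by
  rw [← _root_.sum_card_nbrs]
  refine Finset.sum_subset (Finset.subset_univ W) fun v _ hv => ?_
  rw [Finset.card_eq_zero, Finset.eq_empty_iff_forall_notMem]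
  intro w hw
  exact hv (h.mem_left (mem_nbrs.1 hw))

theorem card_edges_deleteIncidenceSet (p : V) :
    (edges (G.deleteIncidenceSet p)).card + (nbrs G p).card = (edges G).card := by
  classical
  have h := G.card_edgeFinset_deleteIncidenceSet p
  have h1 : G.edgeFinset = edges G := by ext e; simp
  have h2 : (G.deleteIncidenceSet p).edgeFinset = edges (G.deleteIncidenceSet p) := by ext e; simp
  have h3 : G.degree p = (nbrs G p).card := by
    rw [← card_neighborFinset_eq_degree]
    congr 1
    ext w
    simp
  have h4 : G.degree p ≤ G.edgeFinset.card := by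
    rw [← card_incidenceFinset_eq_degree]
    exact Finset.card_le_card (G.incidenceFinset_subset p)
  rw [h2, h1, h3] at h
  rw [h1, h3] at h4
  omega

theorem card_edges_sup_edge (hn : ¬ G.Adj u v) (h : u ≠ v) :
    (edges (G ⊔ edge u v)).card = (edges G).card + 1 := by
  classical
  have h0 := G.card_edgeFinset_sup_edge hn h
  have h1 : G.edgeFinset = edges G := by ext e; simp
  have h2 : (G ⊔ edge u v).edgeFinset = edges (G ⊔ edge u v) := by ext e; simp
  rw [h1, h2] at h0
  exact h0

/-- If the nonempty set `F` contains no core then it spans at most `|F| - 1` edges; this is expressed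
through the degree sum over `F` and a set `E` of edges avoiding `F`. -/
theorem sum_card_nbrs_le_of_not_isCore [DecidableEq V] (F : Finset V) :
    F.Nonempty → (∀ A ⊆ F, ¬ IsCore G A) → ∀ E : Finset (Sym2 V), E ⊆ edges G →
      (∀ e ∈ E, ∀ v ∈ F, v ∉ e) →
      ∑ v ∈ F, (nbrs G v).card + 1 + E.card ≤ (edges G).card + F.card := by
  induction F using Finset.strongInduction with
  | H F ih =>
    intro hF hcore E hE hEF
    obtain ⟨u, hu, hdeg⟩ : ∃ u ∈ F, (nbrs G u ∩ F).card ≤ 1 := by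
      by_contra! hcon
      refine hcore F subset_rfl ⟨hF, fun v hv => ?_⟩
      obtain ⟨a, ha, b, hb, hab⟩ := Finset.one_lt_card.1 (hcon v hv)
      simp only [Finset.mem_inter, mem_nbrs] at ha hb
      exact ⟨a, ha.2, b, hb.2, hab, ha.1, hb.1⟩
    -- The edges from `u` out of `F` join the reserved set `E`. With at most one further edge inside
    -- `F` they make up the degree of `u`, and that one edge is paid for by `|F|` dropping by one.
    set E' := (nbrs G u \ F).image (fun w => s(u, w)) with hE'
    have hcard : E'.card = (nbrs G u \ F).card := by
      refine Finset.card_image_of_injective _ fun a b hab => ?_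
      exact Sym2.congr_right.1 hab
    have hdisj : Disjoint E E' := by
      rw [Finset.disjoint_left]
      intro e he he'
      obtain ⟨w, -, rfl⟩ := Finset.mem_image.1 he'
      exact hEF _ he u hu (by simp)
    have hsub : E ∪ E' ⊆ edges G := by
      refine Finset.union_subset hE fun e he => ?_
      obtain ⟨w, hw, rfl⟩ := Finset.mem_image.1 he
      simpa using (mem_nbrs.1 (Finset.mem_sdiff.1 hw).1)
    have hsplit : (nbrs G u ∩ F).card + (nbrs G u \ F).card = (nbrs G u).card :=
      Finset.card_inter_add_card_sdiff _ _
    have hFc : (F.erase u).card + 1 = F.card := Finset.card_erase_add_one hu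
    rcases (F.erase u).eq_empty_or_nonempty with hemp | hne
    · have hFu : F = {u} := by
        rw [Finset.erase_eq_empty_iff] at hemp
        rcases hemp with h | h
        · exact absurd h hF.ne_empty
        · exact h
      have hz : nbrs G u ∩ F = ∅ := by
        rw [hFu]
        ext w
        simp only [Finset.mem_inter, mem_nbrs, Finset.mem_singleton, Finset.notMem_empty, iff_false]
        rintro ⟨h, rfl⟩
        exact h.ne rfl
      have := Finset.card_le_card hsub
      rw [Finset.card_union_of_disjoint hdisj] at this
      rw [hz, Finset.card_empty] at hsplit
      rw [hFu, Finset.sum_singleton, Finset.card_singleton]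
      omega
    · have := ih (F.erase u) (Finset.erase_ssubset hu) hne
        (fun A hA => hcore A (hA.trans (Finset.erase_subset _ _))) (E ∪ E') hsub (by
          intro e he v hv hve
          rw [Finset.mem_erase] at hv
          rcases Finset.mem_union.1 he with he | he
          · exact hEF e he v hv.2 hve
          · obtain ⟨w, hw, rfl⟩ := Finset.mem_image.1 he
            rw [Finset.mem_sdiff] at hw
            rcases Sym2.mem_iff.1 hve with h | h
            · exact hv.1 h
            · exact hw.2 (h ▸ hv.2))
      rw [Finset.card_union_of_disjoint hdisj] at this
      rw [← Finset.add_sum_erase F _ hu]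
      omega

end Counting

/-! ### Reductions removing one vertex -/

/-- The property of wheels that makes pendant and subdividing vertices impossible: every core
avoiding the hub contains all other vertices. -/
def HasHub {V : Type} (W : Finset V) (G : SimpleGraph V) : Prop :=
  ∃ h ∈ W, ∀ B, IsCore G B → h ∉ B → ∀ t ∈ W, t ≠ h → t ∈ B

section Reduction
variable {V : Type} {G H : SimpleGraph V} {A B W : Finset V} {a b p q u v w x y z : V}

theorem IsCore.mem_of_two (h : IsCore G A) (hv : v ∈ A) (hn : ∀ w, G.Adj v w → w = x ∨ w = y) :
    x ∈ A ∧ y ∈ A := by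
  obtain ⟨a, ha, b, hb, hab, h1, h2⟩ := h.2 v hv
  have := hn a h1
  have := hn b h2
  grind

theorem IsCore.notMem_of_one (h : IsCore G A) (hn : ∀ w, G.Adj p w → w = q) : p ∉ A := by
  intro hp
  obtain ⟨a, ha, b, hb, hab, h1, h2⟩ := h.2 p hp
  exact hab ((hn a h1).trans (hn b h2).symm)

theorem IsCore.delete (h : IsCore G A) (hp : p ∉ A) : IsCore (G.deleteIncidenceSet p) A := by
  refine h.mono fun x hx y hy hxy => deleteIncidenceSet_adj.2 ⟨hxy, ?_, ?_⟩
  · rintro rfl; exact hp hx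
  · rintro rfl; exact hp hy

theorem IsCore.of_delete (h : IsCore (G.deleteIncidenceSet p) A) : IsCore G A :=
  h.mono fun _ _ _ _ hxy => (deleteIncidenceSet_adj.1 hxy).1

theorem IsCore.delete_sup_edge (h : IsCore (G ⊔ edge u v) A) (hp : p ∉ A) :
    IsCore (G.deleteIncidenceSet p ⊔ edge u v) A := by
  refine h.mono fun x hx y hy hxy => ?_
  rw [sup_edge_adj_iff] at hxy ⊢
  rw [deleteIncidenceSet_adj]
  grind

theorem HasTwoCores.of_delete (h : HasTwoCores (G.deleteIncidenceSet p)) : HasTwoCores G := by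
  obtain ⟨A, B, hAB, hA, hB⟩ := h
  exact ⟨A, B, hAB, hA.of_delete, hB.of_delete⟩

/-- Suppressing a vertex of degree two with non-adjacent neighbours keeps cores. -/
theorem IsCore.suppress [DecidableEq V] (h : IsCore H A) (hn : ∀ w, H.Adj v w → w = x ∨ w = y)
    (hxy : ¬ H.Adj x y) (hne : x ≠ y) :
    IsCore (H.deleteIncidenceSet v ⊔ edge x y) (A.erase v) := by
  constructor
  · have := h.three_le_card
    have := Finset.pred_card_le_card_erase (s := A) (a := v)
    exact Finset.card_pos.1 (by omega)
  · intro w hw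
    rw [Finset.mem_erase] at hw
    obtain ⟨c, hc, d, hd, hcd, h1, h2⟩ := h.2 w hw.2
    simp only [sup_edge_adj_iff, deleteIncidenceSet_adj, Finset.mem_erase]
    have hv : v ∈ A → x ∈ A ∧ y ∈ A := fun hv => h.mem_of_two hv hn
    by_cases hcv : c = v
    · subst hcv
      have := hn w h1.symm
      have h3 := hv hc
      grind [SimpleGraph.Adj.symm]
    · by_cases hdv : d = v
      · subst hdv
        have := hn w h2.symm
        have h3 := hv hd
        grind [SimpleGraph.Adj.symm]
      · exact ⟨c, ⟨hcv, hc⟩, d, ⟨hdv, hd⟩, hcd, Or.inl ⟨h1, hw.1, hcv⟩, Or.inl ⟨h2, hw.1, hdv⟩⟩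

/-- The converse of suppression: `v` is put back on the edge `xy`, and an endpoint that used this
edge takes `v` as its neighbour instead. -/
theorem IsCore.subdivide [DecidableEq V] (h : IsCore (G.deleteIncidenceSet v ⊔ edge x y) A)
    (hvx : G.Adj v x) (hvy : G.Adj v y) (hne : x ≠ y) (hx : x ∈ A) (hy : y ∈ A) :
    IsCore G (insert v A) := by
  refine ⟨⟨v, by simp⟩, fun w hw => ?_⟩
  rw [Finset.mem_insert] at hw
  by_cases hwv : w = v
  · subst hwv
    exact ⟨x, by simp [hx], y, by simp [hy], hne, hvx, hvy⟩
  · obtain ⟨c, hc, d, hd, hcd, h1, h2⟩ := h.2 w (hw.resolve_left hwv)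
    simp only [sup_edge_adj_iff, deleteIncidenceSet_adj] at h1 h2
    simp only [Finset.mem_insert]
    have := hvx.symm
    have := hvy.symm
    rcases h1 with h1 | h1 <;> rcases h2 with h2 | h2
    · exact ⟨c, by grind, d, by grind, hcd, h1.1, h2.1⟩
    · exact ⟨c, by grind, v, by grind, h1.2.2, h1.1, by grind⟩
    · exact ⟨d, by grind, v, by grind, h2.2.2, h2.1, by grind⟩
    · grind

namespace SatOn

theorem exists_adj [DecidableEq V] (h : SatOn W G) (hu : u ∈ W) (hW : 2 ≤ W.card) : ∃ v, G.Adj u v := by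
  by_contra! hn
  obtain ⟨v, hv, hvu⟩ := Finset.exists_mem_ne hW u
  obtain ⟨A, B, -, huA, -, hA, -⟩ := h.exists_cores hu hv hvu.symm (hn v)
  refine hA.notMem_of_one (q := v) (fun w hw => ?_) huA
  rw [sup_edge_adj_iff] at hw
  grind

/-- An added edge between two other vertices leaves `p` with at most one neighbour, so `p` lies in
no core involved. -/
theorem delete_leaf [DecidableEq V] (h : SatOn W G) (hp : ∀ w, G.Adj p w → w = q) :
    SatOn (W.erase p) (G.deleteIncidenceSet p) := by
  refine ⟨fun u v huv => ?_, fun ht => h.free ht.of_delete, fun u hu v hv huv hadj => ?_⟩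
  · rw [deleteIncidenceSet_adj] at huv
    exact Finset.mem_erase.2 ⟨huv.2.1, h.mem_left huv.1⟩
  · rw [Finset.mem_erase] at hu hv
    obtain ⟨A, B, hAB, -, -, hA, hB, -⟩ := h.exists_cores hu.2 hv.2 huv
      (fun ha => hadj (deleteIncidenceSet_adj.2 ⟨ha, hu.1, hv.1⟩))
    refine ⟨A, B, hAB, hA.delete_sup_edge ?_, (hB.delete (hB.notMem_of_one hp)).sup_edge⟩
    refine hA.notMem_of_one (q := q) fun w hw => ?_
    rw [sup_edge_adj_iff] at hw
    grind

/-- Join `p` to `t`, with `q` or `t` the hub. The core through `pt` contains `q`, so the other core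
avoids the hub; it then has to contain whichever of `q`, `t` is not the hub, and meets the first
core. -/
theorem false_of_leaf [DecidableEq V] (h : SatOn W G) (hpq : G.Adj p q)
    (hp : ∀ w, G.Adj p w → w = q) (hW : 3 ≤ W.card)
    (hub : HasHub (W.erase p) (G.deleteIncidenceSet p)) : False := by
  obtain ⟨c, hc, hub⟩ := hub
  obtain ⟨hcp, hcW⟩ := Finset.mem_erase.1 hc
  have key : ∀ t ∈ W, t ≠ p → t ≠ q → (q = c ∨ t = c) → False := by
    intro t ht htp htq hqt
    obtain ⟨A, B, hAB, hpA, htA, hA, hB, -⟩ := h.exists_cores (h.mem_left hpq) ht htp.symm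
      (fun ha => htq (hp t ha))
    have hqA : q ∈ A := (hA.mem_of_two (x := q) (y := t) hpA fun w hw => by
      rw [sup_edge_adj_iff] at hw
      grind).1
    have hd := Finset.disjoint_left.1 hAB
    have := hub B (hB.delete (hd hpA)) (by grind)
    have hqW := h.mem_right hpq
    have := hpq.ne
    rcases hqt with rfl | rfl
    · exact hd htA (this t (by grind) htq)
    · exact hd hqA (this q (by grind) (Ne.symm htq))
  by_cases hqc : q = c
  · obtain ⟨t, ht, h1⟩ : ∃ t ∈ W, t ∉ ({p, q} : Finset V) := by
      by_contra! hcon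
      have := (Finset.card_le_card (s := W) (t := {p, q}) hcon).trans Finset.card_le_two
      omega
    simp only [Finset.mem_insert, Finset.mem_singleton, not_or] at h1
    exact key t ht h1.1 h1.2 (Or.inl hqc)
  · exact key c hcW hcp (Ne.symm hqc) (Or.inr rfl)

/-- Cores of the smaller graph lift by subdividing `xy` with `v`; cores of `G + ab` descend by
dropping `v`. -/
theorem suppress [DecidableEq V] (h : SatOn W G) (hvx : G.Adj v x) (hvy : G.Adj v y) (hne : x ≠ y)
    (hn : ∀ w, G.Adj v w → w = x ∨ w = y) (hxy : ¬ G.Adj x y) :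
    SatOn (W.erase v) (G.deleteIncidenceSet v ⊔ edge x y) := by
  have hxW := h.mem_right hvx
  have hyW := h.mem_right hvy
  have hxv := hvx.ne
  have hyv := hvy.ne
  refine ⟨fun a b hab => ?_, ?_, fun a ha b hb hab hadj => ?_⟩
  · rw [sup_edge_adj_iff, deleteIncidenceSet_adj] at hab
    have := h.supp a b
    grind
  · rintro ⟨A, B, hAB, hA, hB⟩
    have hv : ∀ C, IsCore (G.deleteIncidenceSet v ⊔ edge x y) C → v ∉ C := fun C hC =>
      hC.notMem_of_one (q := v) fun w hw => by
        rw [sup_edge_adj_iff, deleteIncidenceSet_adj] at hw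
        grind
    have hd := Finset.disjoint_left.1 hAB
    by_cases h1 : x ∈ A ∧ y ∈ A
    · refine h.free ⟨insert v A, B, ?_, hA.subdivide hvx hvy hne h1.1 h1.2,
        (hB.of_sup_edge (Or.inl (hd h1.1))).of_delete⟩
      rw [Finset.disjoint_insert_left]
      exact ⟨hv B hB, hAB⟩
    · have h2 := (hA.of_sup_edge (by tauto)).of_delete
      by_cases h3 : x ∈ B ∧ y ∈ B
      · refine h.free ⟨A, insert v B, ?_, h2, hB.subdivide hvx hvy hne h3.1 h3.2⟩
        rw [Finset.disjoint_insert_right]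
        exact ⟨hv A hA, hAB⟩
      · exact h.free ⟨A, B, hAB, h2, (hB.of_sup_edge (by tauto)).of_delete⟩
  · rw [sup_edge_adj_iff, deleteIncidenceSet_adj] at hadj
    rw [Finset.mem_erase] at ha hb
    obtain ⟨A, B, hAB, -, -, hA, hB, -⟩ := h.exists_cores ha.2 hb.2 hab (by grind)
    refine ⟨A.erase v, B.erase v, ?_, ?_, (hB.suppress hn hxy hne).sup_edge⟩
    · exact hAB.mono (Finset.erase_subset _ _) (Finset.erase_subset _ _)
    · refine (hA.suppress (v := v) (x := x) (y := y) (fun w hw => ?_) (fun hw => ?_) hne).mono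
        fun s _ t _ hst => ?_
      · rw [sup_edge_adj_iff] at hw
        grind
      · rw [sup_edge_adj_iff] at hw
        grind
      · simp only [sup_edge_adj_iff, deleteIncidenceSet_adj] at hst ⊢
        grind

/-- If the hub is `x` or `y`, join `x` to `y`: the second core avoids the hub, hence contains the
other of the two. If not, join `v` to the hub: the second core takes all remaining vertices and the
first has only two. -/
theorem false_of_suppress [DecidableEq V] (h : SatOn W G) (hvx : G.Adj v x) (hvy : G.Adj v y)
    (hne : x ≠ y) (hn : ∀ w, G.Adj v w → w = x ∨ w = y) (hxy : ¬ G.Adj x y)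
    (hub : HasHub (W.erase v) (G.deleteIncidenceSet v ⊔ edge x y)) : False := by
  obtain ⟨c, hc, hub⟩ := hub
  obtain ⟨hcv, hcW⟩ := Finset.mem_erase.1 hc
  have hxW := h.mem_right hvx
  have hyW := h.mem_right hvy
  have hxv := hvx.ne
  have hyv := hvy.ne
  by_cases hcxy : c = x ∨ c = y
  · obtain ⟨A, B, hAB, hxA, hyA, hA, hB, -⟩ := h.exists_cores hxW hyW hne hxy
    have hd := Finset.disjoint_left.1 hAB
    have hvB : v ∉ B := fun hvB => hd hxA (hB.mem_of_two hvB hn).1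
    have := hub B (hB.delete hvB).sup_edge (by grind)
    rcases hcxy with rfl | rfl
    · exact hd hyA (this y (by grind) hne.symm)
    · exact hd hxA (this x (by grind) hne)
  · have hvW := h.mem_left hvx
    obtain ⟨A, B, hAB, hvA, hcA, hA, hB, hAW, -⟩ := h.exists_cores hvW hcW hcv.symm (by grind)
    have hd := Finset.disjoint_left.1 hAB
    have := hub B (hB.delete (hd hvA)).sup_edge (hd hcA)
    refine hA.not_subset_pair (u := v) (v := c) fun t ht => ?_
    have := hAW ht
    have := hd ht
    grind

/-- A core through `v` contains `x` and `y`. If it is the core of `G`, the triangle `wxy` replaces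
it; if it is the core through the added edge, `w` takes the place of `v`. -/
theorem delete_twin [DecidableEq V] (h : SatOn W G) (hvw : v ≠ w)
    (hwx : G.Adj w x) (hwy : G.Adj w y) (hvn : ∀ t, G.Adj v t → t = x ∨ t = y)
    (hwn : ∀ t, G.Adj w t → t = x ∨ t = y) (hxy : G.Adj x y) :
    SatOn (W.erase v) (G.deleteIncidenceSet v) := by
  refine ⟨fun a b hab => ?_, fun ht => h.free ht.of_delete, fun a ha b hb hab hadj => ?_⟩
  · rw [deleteIncidenceSet_adj] at hab
    exact Finset.mem_erase.2 ⟨hab.2.1, h.mem_left hab.1⟩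
  · rw [Finset.mem_erase] at ha hb
    obtain ⟨A, B, hAB, haA, hbA, hA, hB, -⟩ := h.exists_cores ha.2 hb.2 hab
      (fun hadj' => hadj (deleteIncidenceSet_adj.2 ⟨hadj', ha.1, hb.1⟩))
    have hd := Finset.disjoint_left.1 hAB
    have hxy' := hxy.ne
    by_cases hvB : v ∈ B
    · obtain ⟨hxB, hyB⟩ := hB.mem_of_two hvB hvn
      -- Since `x` and `y` lie in `B`, only the added edge could give `w` a neighbour in `A`.
      have hwA : w ∉ A := by
        intro hwA
        obtain ⟨c, hc, d, hdA, hcd, h1, h2⟩ := hA.2 w hwA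
        rw [sup_edge_adj_iff] at h1 h2
        have := hwn c
        have := hwn d
        grind
      refine ⟨A, {w, x, y}, ?_, hA.delete_sup_edge fun hvA => hd hvA hvB,
        ((isCore_triangle hwx hxy hwy).delete ?_).sup_edge⟩
      · rw [Finset.disjoint_right]
        grind
      · have := hwx.ne
        have := hwy.ne
        have h1 : v ≠ x := by
          rintro rfl
          have := hvn w hwx.symm
          grind
        have h2 : v ≠ y := by
          rintro rfl
          have := hvn w hwy.symm
          grind
        simp [hvw, h1, h2]
    · by_cases hvA : v ∈ A
      · have hvn' : ∀ t, (G ⊔ edge a b).Adj v t → t = x ∨ t = y := fun t ht => by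
          rw [sup_edge_adj_iff] at ht
          grind
        obtain ⟨hxA, hyA⟩ := hA.mem_of_two hvA hvn'
        have hwB : w ∉ B := fun hwB => hd hxA (hB.mem_of_two hwB hwn).1
        refine ⟨insert w (A.erase v), B, ?_, ⟨⟨w, by simp⟩, fun t ht => ?_⟩,
          (hB.delete hvB).sup_edge⟩
        · rw [Finset.disjoint_left]
          grind
        · have hvx : v ≠ x := by
            rintro rfl
            have := hvn w hwx.symm
            have := hwx.ne
            have := hwy.ne
            grind
          have hvy : v ≠ y := by
            rintro rfl
            have := hvn w hwy.symm
            have := hwx.ne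
            have := hwy.ne
            grind
          have hwx' := hwx.symm
          have hwy' := hwy.symm
          have hxy2 := hxy.symm
          have e1 := hwx.ne
          have e2 := hwy.ne
          simp only [sup_edge_adj_iff, deleteIncidenceSet_adj, Finset.mem_insert, Finset.mem_erase]
          by_cases htw : t = w
          · subst htw
            exact ⟨x, by grind, y, by grind, by grind, by grind, by grind⟩
          by_cases htx : t = x
          · subst htx
            exact ⟨w, by grind, y, by grind, by grind, by grind, by grind⟩
          by_cases hty : t = y
          · subst hty
            exact ⟨w, by grind, x, by grind, by grind, by grind, by grind⟩
          · obtain ⟨c, hc, d, hdA, hcd, h1, h2⟩ := hA.2 t (by grind)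
            have hc' : c ≠ v := by
              rintro rfl
              have := hvn' t h1.symm
              grind
            have hd' : d ≠ v := by
              rintro rfl
              have := hvn' t h2.symm
              grind
            rw [sup_edge_adj_iff] at h1 h2
            exact ⟨c, by grind, d, by grind, hcd, by grind, by grind⟩
      · exact ⟨A, B, hAB, hA.delete_sup_edge hvA, (hB.delete hvB).sup_edge⟩

end SatOn
end Reduction

/-! ### Six vertices -/

section SixVertices

/-- The wheel on six labelled vertices, with hub `5`. -/
def wheelAdj (i j : Fin 6) : Bool :=
  i != j && (i == 5 || j == 5 || (i.val + 1) % 5 == j.val || (j.val + 1) % 5 == i.val)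

/-- The set `W` carries a spanning wheel of `G`, and nothing else. -/
def IsWheelOn {V : Type} (W : Finset V) (G : SimpleGraph V) : Prop :=
  ∃ g : Fin 6 → V, Function.Injective g ∧ (∀ i, g i ∈ W) ∧
    ∀ i j, G.Adj (g i) (g j) ↔ wheelAdj i j = true

/-- A set avoiding the hub lies in the rim, a five-cycle, whose only core is the whole rim. -/
theorem wheelAdj_core : ∀ s : Finset (Fin 6), s.Nonempty → 5 ∉ s →
    (∀ i ∈ s, ∃ a ∈ s, ∃ b ∈ s, a ≠ b ∧ wheelAdj i a = true ∧ wheelAdj i b = true) →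
    ∀ t, t ≠ 5 → t ∈ s := by
  decide +kernel

theorem exists_label_of_card {V : Type} [DecidableEq V] {W : Finset V} {n : ℕ} {g : Fin n → V}
    (hg : Function.Injective g) (hW : ∀ i, g i ∈ W) (hc : W.card = n) {v : V} (hv : v ∈ W) :
    ∃ i, g i = v := by
  have h : Finset.univ.image g = W := by
    refine Finset.eq_of_subset_of_card_le (fun x hx => ?_) ?_
    · obtain ⟨i, -, rfl⟩ := Finset.mem_image.1 hx
      exact hW i
    · rw [Finset.card_image_of_injective _ hg, hc, Finset.card_univ, Fintype.card_fin]
  rw [← h] at hv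
  obtain ⟨i, -, hi⟩ := Finset.mem_image.1 hv
  exact ⟨i, hi⟩

theorem IsWheelOn.hasHub {V : Type} [DecidableEq V] {W : Finset V} {G : SimpleGraph V}
    (h : IsWheelOn W G) (hc : W.card = 6) (hs : ∀ u v, G.Adj u v → u ∈ W) : HasHub W G := by
  obtain ⟨g, hg, hgW, hadj⟩ := h
  refine ⟨g 5, hgW 5, fun B hB h5 t ht ht5 => ?_⟩
  have lab : ∀ v ∈ W, ∃ i, g i = v := fun v hv => exists_label_of_card hg hgW hc hv
  obtain ⟨i, rfl⟩ := lab t ht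
  have hBW : ∀ v ∈ B, v ∈ W := fun v hv => by
    obtain ⟨a, -, -, -, -, h1, -⟩ := hB.2 v hv
    exact hs _ _ h1
  have := wheelAdj_core (Finset.univ.filter fun i => g i ∈ B) ?_ (by simpa using h5) ?_ i
    (fun hi => ht5 (by rw [hi]))
  · simpa using this
  · obtain ⟨v, hv⟩ := hB.1
    obtain ⟨j, rfl⟩ := lab v (hBW v hv)
    exact ⟨j, by simpa using hv⟩
  · intro j hj
    simp only [Finset.mem_filter, Finset.mem_univ, true_and] at hj ⊢
    obtain ⟨a, ha, b, hb, hab, h1, h2⟩ := hB.2 _ hj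
    obtain ⟨a, rfl⟩ := lab a (hBW a ha)
    obtain ⟨b, rfl⟩ := lab b (hBW b hb)
    exact ⟨a, ha, b, hb, fun h => hab (by rw [h]), (hadj _ _).1 h1, (hadj _ _).1 h2⟩

/-- Three labels span a triangle. -/
def isTri (M : Fin 6 → Fin 6 → Bool) (i j k : Fin 6) : Bool := M i j && M j k && M i k

/-- The six labels split into two triangles. -/
def hasTri (M : Fin 6 → Fin 6 → Bool) : Bool :=
  isTri M 0 1 2 && isTri M 3 4 5 || isTri M 0 1 3 && isTri M 2 4 5 ||
  isTri M 0 1 4 && isTri M 2 3 5 || isTri M 0 1 5 && isTri M 2 3 4 ||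
  isTri M 0 2 3 && isTri M 1 4 5 || isTri M 0 2 4 && isTri M 1 3 5 ||
  isTri M 0 2 5 && isTri M 1 3 4 || isTri M 0 3 4 && isTri M 1 2 5 ||
  isTri M 0 3 5 && isTri M 1 2 4 || isTri M 0 4 5 && isTri M 1 2 3

/-- Join two labels. -/
def addPair (M : Fin 6 → Fin 6 → Bool) (i j : Fin 6) : Fin 6 → Fin 6 → Bool := fun k l =>
  M k l || (k == i && l == j) || (k == j && l == i)

/-- Number of joined pairs. -/
def countPairs (M : Fin 6 → Fin 6 → Bool) : ℕ :=
  (M 0 1).toNat + (M 0 2).toNat + (M 0 3).toNat + (M 0 4).toNat + (M 0 5).toNat +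
  (M 1 2).toNat + (M 1 3).toNat + (M 1 4).toNat + (M 1 5).toNat +
  (M 2 3).toNat + (M 2 4).toNat + (M 2 5).toNat +
  (M 3 4).toNat + (M 3 5).toNat + (M 4 5).toNat

/-- Candidate labellings of a wheel containing the path `0, 2, 1` in its rim. -/
def wheelLabels : List (Fin 6 → Fin 6) :=
  [![0, 2, 1, 3, 4, 5], ![0, 2, 1, 4, 3, 5], ![0, 2, 1, 3, 5, 4], ![0, 2, 1, 5, 3, 4],
    ![0, 2, 1, 4, 5, 3], ![0, 2, 1, 5, 4, 3]]

/-- Two triangles, minus the pair `0, 1`, plus nine arbitrary pairs between them. -/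
def crossMatrix (a b c d e f g h i : Bool) : Fin 6 → Fin 6 → Bool :=
  ![![false, false, true, a, b, c], ![false, false, true, d, e, f], ![true, true, false, g, h, i],
    ![a, d, g, false, true, true], ![b, e, h, true, false, true], ![c, f, i, true, true, false]]

/-- Six labellings suffice: `0` and `1` are non-adjacent, hence on the rim, and `2` is not the hub,
since `3, 4, 5` would then be a triangle in the rim. So `0, 2, 1` is a rim path and only the roles
of `3, 4, 5` are free. -/
theorem crossMatrix_check : ∀ a b c d e f g h i : Bool,
    hasTri (crossMatrix a b c d e f g h i) = false →
    (∀ k l, k ≠ l → crossMatrix a b c d e f g h i k l = false →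
      hasTri (addPair (crossMatrix a b c d e f g h i) k l) = true) →
    11 ≤ countPairs (crossMatrix a b c d e f g h i) ∨
      countPairs (crossMatrix a b c d e f g h i) = 10 ∧ ∃ p ∈ wheelLabels, Function.Injective p ∧
        ∀ k l, crossMatrix a b c d e f g h i (p k) (p l) = wheelAdj k l := by
  decide +kernel

end SixVertices

section SixVertices

theorem hasTri_of_split {M : Fin 6 → Fin 6 → Bool} (s : Finset (Fin 6)) (hs : s.card = 3)
    (h1 : ∀ k ∈ s, ∀ l ∈ s, k ≠ l → M k l = true) (h2 : ∀ k ∉ s, ∀ l ∉ s, k ≠ l → M k l = true) :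
    hasTri M = true := by
  have key : ∀ s : Finset (Fin 6), s.card = 3 → s = {0, 1, 2} ∨ s = {3, 4, 5} ∨ s = {0, 1, 3} ∨
      s = {2, 4, 5} ∨ s = {0, 1, 4} ∨ s = {2, 3, 5} ∨ s = {0, 1, 5} ∨ s = {2, 3, 4} ∨
      s = {0, 2, 3} ∨ s = {1, 4, 5} ∨ s = {0, 2, 4} ∨ s = {1, 3, 5} ∨ s = {0, 2, 5} ∨
      s = {1, 3, 4} ∨ s = {0, 3, 4} ∨ s = {1, 2, 5} ∨ s = {0, 3, 5} ∨ s = {1, 2, 4} ∨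
      s = {0, 4, 5} ∨ s = {1, 2, 3} := by decide +kernel
  rcases key s hs with rfl | rfl | rfl | rfl | rfl | rfl | rfl | rfl | rfl | rfl | rfl | rfl |
    rfl | rfl | rfl | rfl | rfl | rfl | rfl | rfl <;>
  · simp only [hasTri, isTri, Bool.or_eq_true, Bool.and_eq_true]
    simp only [Finset.mem_insert, Finset.mem_singleton] at h1 h2
    simp [h1, h2]

variable {V : Type} {G : SimpleGraph V} {A B W : Finset V} {u v : V}

theorem IsCore.adj_of_card_three (h : IsCore G A) (hc : A.card = 3) (hu : u ∈ A) (hv : v ∈ A)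
    (huv : u ≠ v) : G.Adj u v := by
  classical
  obtain ⟨a, ha, b, hb, hab, h1, h2⟩ := h.2 u hu
  have h3 : ({u, a, b} : Finset V) = A := by
    refine Finset.eq_of_subset_of_card_le (fun t ht => ?_) ?_
    · simp only [Finset.mem_insert, Finset.mem_singleton] at ht
      rcases ht with rfl | rfl | rfl <;> assumption
    · rw [hc, Finset.card_eq_three.2 ⟨u, a, b, h1.ne, h2.ne, hab, rfl⟩]
  rw [← h3] at hv
  simp only [Finset.mem_insert, Finset.mem_singleton] at hv
  rcases hv with rfl | rfl | rfl
  · exact absurd rfl huv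
  · exact h1
  · exact h2

theorem card_eq_three_of_cores (hc : W.card = 6) (hAB : Disjoint A B) (hA : 3 ≤ A.card)
    (hB : 3 ≤ B.card) (hAW : A ⊆ W) (hBW : B ⊆ W) :
    A.card = 3 ∧ B.card = 3 ∧ ∀ t ∈ W, t ∈ A ∨ t ∈ B := by
  classical
  have h1 := Finset.card_union_of_disjoint hAB
  have h2 : A ∪ B ⊆ W := Finset.union_subset hAW hBW
  have h3 := Finset.card_le_card h2
  refine ⟨by omega, by omega, fun t ht => ?_⟩
  rw [← Finset.eq_of_subset_of_card_le h2 (by omega)] at ht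
  exact Finset.mem_union.1 ht

theorem SatOn.hasTri_addPair [DecidableEq V] (h : SatOn W G) (hc : W.card = 6) {f : Fin 6 → V}
    (hf : Function.Injective f) (hfW : ∀ i, f i ∈ W) {M : Fin 6 → Fin 6 → Bool}
    (hM : ∀ i j, G.Adj (f i) (f j) ↔ M i j = true) {k l : Fin 6} (hkl : k ≠ l)
    (hMkl : M k l = false) : hasTri (addPair M k l) = true := by
  obtain ⟨A, B, hAB, -, -, hA, hB, hAW, hBW⟩ := h.exists_cores (hfW k) (hfW l) (hf.ne hkl)
    (by rw [hM, hMkl]; simp)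
  obtain ⟨h1, h2, h3⟩ := card_eq_three_of_cores hc hAB hA.three_le_card hB.three_le_card hAW hBW
  have hadd : ∀ i j, (G ⊔ edge (f k) (f l)).Adj (f i) (f j) → addPair M k l i j = true := by
    intro i j hij
    rw [sup_edge_adj_iff, hM] at hij
    simp only [addPair, Bool.or_eq_true, Bool.and_eq_true, beq_iff_eq]
    simp only [hf.eq_iff] at hij
    tauto
  refine hasTri_of_split (Finset.univ.filter fun i => f i ∈ A) ?_ ?_ ?_
  · rw [← h1, ← Finset.card_image_of_injective _ hf]
    congr 1
    ext t
    simp only [Finset.mem_image, Finset.mem_filter, Finset.mem_univ, true_and]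
    constructor
    · rintro ⟨i, hi, rfl⟩
      exact hi
    · intro ht
      obtain ⟨i, rfl⟩ := exists_label_of_card hf hfW hc (hAW ht)
      exact ⟨i, ht, rfl⟩
  · intro i hi j hj hij
    simp only [Finset.mem_filter, Finset.mem_univ, true_and] at hi hj
    exact hadd _ _ (hA.adj_of_card_three h1 hi hj (hf.ne hij))
  · intro i hi j hj hij
    simp only [Finset.mem_filter, Finset.mem_univ, true_and] at hi hj
    exact hadd _ _ (Or.inl (hB.adj_of_card_three h2 ((h3 _ (hfW i)).resolve_left hi)
      ((h3 _ (hfW j)).resolve_left hj) (hf.ne hij)))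

theorem SatOn.hasTri_eq_false (h : SatOn W G) {f : Fin 6 → V} (hf : Function.Injective f)
    {M : Fin 6 → Fin 6 → Bool} (hM : ∀ i j, G.Adj (f i) (f j) ↔ M i j = true) :
    hasTri M = false := by
  have key : ∀ i j k a b c : Fin 6, (i ≠ a ∧ i ≠ b ∧ i ≠ c ∧ j ≠ a ∧ j ≠ b ∧ j ≠ c ∧ k ≠ a ∧
      k ≠ b ∧ k ≠ c) → (isTri M i j k && isTri M a b c) = false := by
    rintro i j k a b c ⟨e1, e2, e3, e4, e5, e6, e7, e8, e9⟩
    rw [Bool.eq_false_iff]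
    intro ht
    simp only [isTri, Bool.and_eq_true, ← hM] at ht
    exact not_triangles h.free ht.1.1.1 ht.1.1.2 ht.1.2 ht.2.1.1 ht.2.1.2 ht.2.2 (hf.ne e1)
      (hf.ne e2) (hf.ne e3) (hf.ne e4) (hf.ne e5) (hf.ne e6) (hf.ne e7) (hf.ne e8) (hf.ne e9)
  unfold hasTri
  rw [key _ _ _ _ _ _ (by decide), key _ _ _ _ _ _ (by decide), key _ _ _ _ _ _ (by decide),
    key _ _ _ _ _ _ (by decide), key _ _ _ _ _ _ (by decide), key _ _ _ _ _ _ (by decide),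
    key _ _ _ _ _ _ (by decide), key _ _ _ _ _ _ (by decide), key _ _ _ _ _ _ (by decide),
    key _ _ _ _ _ _ (by decide)]
  rfl

theorem SatOn.card_edges_eq_countPairs [Fintype V] [DecidableEq V] (h : SatOn W G) (hc : W.card = 6) {f : Fin 6 → V}
    (hf : Function.Injective f) (hfW : ∀ i, f i ∈ W) {M : Fin 6 → Fin 6 → Bool}
    (hM : ∀ i j, G.Adj (f i) (f j) ↔ M i j = true) : (edges G).card = countPairs M := by
  have himg : Finset.univ.image f = W := by
    ext t
    constructor
    · intro ht
      obtain ⟨i, -, rfl⟩ := Finset.mem_image.1 ht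
      exact hfW i
    · intro ht
      obtain ⟨i, rfl⟩ := exists_label_of_card hf hfW hc ht
      simp
  have hdeg : ∀ i, (nbrs G (f i)).card = ∑ j, (M i j).toNat := by
    intro i
    have : nbrs G (f i) = (Finset.univ.filter fun j => M i j = true).image f := by
      ext t
      simp only [mem_nbrs, Finset.mem_image, Finset.mem_filter, Finset.mem_univ, true_and]
      constructor
      · intro ht
        obtain ⟨j, rfl⟩ := exists_label_of_card hf hfW hc (h.mem_right ht)
        exact ⟨j, (hM _ _).1 ht, rfl⟩
      · rintro ⟨j, hj, rfl⟩
        exact (hM _ _).2 hj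
    rw [this, Finset.card_image_of_injective _ hf, Finset.card_filter]
    refine Finset.sum_congr rfl fun j _ => ?_
    cases M i j <;> rfl
  have hsum := h.sum_card_nbrs
  rw [← himg, Finset.sum_image (fun _ _ _ _ h => hf h)] at hsum
  simp only [hdeg] at hsum
  have hsymm : ∀ i j, M i j = M j i := fun i j => by
    rw [Bool.eq_iff_iff, ← hM, ← hM, G.adj_comm]
  have hirr : ∀ i, M i i = false := fun i => by
    rw [Bool.eq_false_iff, ne_eq, ← hM]
    exact G.loopless.irrefl _
  simp only [Fin.sum_univ_six, hirr, Bool.toNat_false] at hsum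
  rw [hsymm 1 0, hsymm 2 0, hsymm 2 1, hsymm 3 0, hsymm 3 1, hsymm 3 2, hsymm 4 0, hsymm 4 1,
    hsymm 4 2, hsymm 4 3, hsymm 5 0, hsymm 5 1, hsymm 5 2, hsymm 5 3, hsymm 5 4] at hsum
  unfold countPairs
  omega

/-- `K₆` has two disjoint triangles, so some pair `u`, `v` is non-adjacent. The cores of `G + uv`
have three vertices each, hence are triangles `uvw` and `abc`; only the nine pairs between them are
undetermined. -/
theorem SatOn.six_le [Fintype V] [DecidableEq V] (h : SatOn W G) (hc : W.card = 6) :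
    11 ≤ (edges G).card ∨ (edges G).card = 10 ∧ IsWheelOn W G := by
  obtain ⟨u, hu, v, hv, huv, hadj⟩ : ∃ u ∈ W, ∃ v ∈ W, u ≠ v ∧ ¬ G.Adj u v := by
    by_contra! hcon
    let f : Fin 6 → V := fun i => (W.equivFinOfCardEq hc).symm i
    have hf : Function.Injective f :=
      Subtype.val_injective.comp (W.equivFinOfCardEq hc).symm.injective
    have hfW : ∀ i, f i ∈ W := fun i => ((W.equivFinOfCardEq hc).symm i).2
    have ha : ∀ i j, i ≠ j → G.Adj (f i) (f j) := fun i j hij =>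
      hcon _ (hfW i) _ (hfW j) (hf.ne hij)
    exact not_triangles h.free (ha 0 1 (by decide)) (ha 1 2 (by decide)) (ha 0 2 (by decide))
      (ha 3 4 (by decide)) (ha 4 5 (by decide)) (ha 3 5 (by decide)) (hf.ne (by decide))
      (hf.ne (by decide)) (hf.ne (by decide)) (hf.ne (by decide)) (hf.ne (by decide))
      (hf.ne (by decide)) (hf.ne (by decide)) (hf.ne (by decide)) (hf.ne (by decide))
  obtain ⟨A, B, hAB, huA, hvA, hA, hB, hAW, hBW⟩ := h.exists_cores hu hv huv hadj
  obtain ⟨h1, h2, -⟩ := card_eq_three_of_cores hc hAB hA.three_le_card hB.three_le_card hAW hBW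
  obtain ⟨w, hwA⟩ : ∃ w, A = {u, v, w} := by
    have h3 : ((A.erase u).erase v).card = 1 := by
      rw [Finset.card_erase_of_mem (by simp [huv.symm, hvA]), Finset.card_erase_of_mem huA, h1]
    obtain ⟨w, hw⟩ := Finset.card_eq_one.1 h3
    refine ⟨w, ?_⟩
    rw [← hw, Finset.insert_erase (by simp [huv.symm, hvA]), Finset.insert_erase huA]
  obtain ⟨a, b, c, hab, hac, hbc, rfl⟩ := Finset.card_eq_three.1 h2
  have hd := Finset.disjoint_left.1 hAB
  have hw : w ∈ A := by simp [hwA]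
  have hua : a ∈ ({a, b, c} : Finset V) := by simp
  have hub : b ∈ ({a, b, c} : Finset V) := by simp
  have huc : c ∈ ({a, b, c} : Finset V) := by simp
  have huw : u ≠ w := by
    rintro rfl
    rw [hwA, show ({u, v, u} : Finset V) = {u, v} by ext; simp; tauto] at h1
    exact absurd (h1 ▸ Finset.card_le_two) (by norm_num)
  have hvw : v ≠ w := by
    rintro rfl
    rw [hwA, show ({u, v, v} : Finset V) = {u, v} by ext; simp] at h1
    exact absurd (h1 ▸ Finset.card_le_two) (by norm_num)
  have e1 : G.Adj u w := by
    have := hA.adj_of_card_three h1 huA hw huw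
    rw [sup_edge_adj_iff] at this
    grind
  have e2 : G.Adj v w := by
    have := hA.adj_of_card_three h1 hvA hw hvw
    rw [sup_edge_adj_iff] at this
    grind
  have e3 := hB.adj_of_card_three h2 hua hub hab
  have e4 := hB.adj_of_card_three h2 hua huc hac
  have e5 := hB.adj_of_card_three h2 hub huc hbc
  let f : Fin 6 → V := ![u, v, w, a, b, c]
  have hne : ∀ s ∈ A, ∀ t ∈ ({a, b, c} : Finset V), s ≠ t := fun s hs t ht hst =>
    hd hs (hst ▸ ht)
  have hf : Function.Injective f := by
    have := hne u huA a hua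
    have := hne u huA b hub
    have := hne u huA c huc
    have := hne v hvA a hua
    have := hne v hvA b hub
    have := hne v hvA c huc
    have := hne w hw a hua
    have := hne w hw b hub
    have := hne w hw c huc
    clear hadj hA hB hd hne e1 e2 e3 e4 e5
    intro i j hij
    fin_cases i <;> fin_cases j <;> first | rfl | (exfalso; simp [f] at hij; grind)
  have hfW : ∀ i, f i ∈ W := by
    intro i
    fin_cases i
    exacts [hu, hv, hAW hw, hBW hua, hBW hub, hBW huc]
  let M : Fin 6 → Fin 6 → Bool := fun i j => @decide (G.Adj (f i) (f j)) (Classical.propDecidable _)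
  have hM : ∀ i j, G.Adj (f i) (f j) ↔ M i j = true := fun i j => by simp [M]
  obtain ⟨x1, x2, x3, x4, x5, x6, x7, x8, x9, hx⟩ : ∃ x1 x2 x3 x4 x5 x6 x7 x8 x9,
      M = crossMatrix x1 x2 x3 x4 x5 x6 x7 x8 x9 := by
    refine ⟨M 0 3, M 0 4, M 0 5, M 1 3, M 1 4, M 1 5, M 2 3, M 2 4, M 2 5, ?_⟩
    have hadj' : ¬ G.Adj v u := fun h => hadj h.symm
    have hsymm : ∀ i j, M i j = M j i := fun i j => by
      rw [Bool.eq_iff_iff, ← hM, ← hM, G.adj_comm]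
    funext i j
    fin_cases i <;> fin_cases j <;> first
      | rfl
      | exact hsymm _ _
      | simp [M, f, crossMatrix, e1, e2, e3, e4, e5, e1.symm, e2.symm, e3.symm, e4.symm, e5.symm,
          hadj, hadj']
  rw [h.card_edges_eq_countPairs hc hf hfW hM]
  have hno := h.hasTri_eq_false hf hM
  have hsat : ∀ k l, k ≠ l → M k l = false → hasTri (addPair M k l) = true :=
    fun k l hkl hMkl => h.hasTri_addPair hc hf hfW hM hkl hMkl
  rw [hx] at hno hsat ⊢
  refine (crossMatrix_check _ _ _ _ _ _ _ _ _ hno hsat).imp id fun ⟨h10, p, _, hp, hpw⟩ =>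
    ⟨h10, fun i => f (p i), hf.comp hp, fun i => hfW _, fun i j => ?_⟩
  rw [hM, hx, hpw]

end SixVertices

/-! ### Reduced graphs and ears -/

/-- `v` has degree two and spans a triangle with its neighbours `x` and `y`. -/
structure IsEar {V : Type} (G : SimpleGraph V) (v x y : V) : Prop where
  left : G.Adj v x
  right : G.Adj v y
  base : G.Adj x y
  nbr : ∀ w, G.Adj v w → w = x ∨ w = y

/-- A saturated graph to which none of the reductions applies. -/
structure ReducedOn {V : Type} [Fintype V] (W : Finset V) (G : SimpleGraph V) : Prop
    extends SatOn W G where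
  two_le : ∀ v ∈ W, 2 ≤ (nbrs G v).card
  exists_ear : ∀ v ∈ W, (nbrs G v).card = 2 → ∃ x y, IsEar G v x y
  twin : ∀ v w x y, IsEar G v x y → IsEar G w x y → v = w

/-- The vertices of degree two. -/
noncomputable def earSet {V : Type} [Fintype V] (W : Finset V) (G : SimpleGraph V) : Finset V :=
  W.filter fun v => (nbrs G v).card = 2

theorem IsEar.swap {V : Type} {G : SimpleGraph V} {v x y : V} (h : IsEar G v x y) :
    IsEar G v y x :=
  ⟨h.right, h.left, h.base.symm, fun w hw => (h.nbr w hw).symm⟩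

section Ears
variable {V : Type} [Fintype V] {G : SimpleGraph V} {W F S : Finset V}
  {u v w x y z p q : V}

theorem sum_card_nbrs_le_of_isIndep (hF : ∀ u ∈ F, ∀ v ∈ F, ¬ G.Adj u v) :
    ∑ v ∈ F, (nbrs G v).card ≤ (edges G).card := by
  rw [← Finset.card_sigma]
  refine Finset.card_le_card_of_injOn (fun e => s(e.1, e.2)) ?_ ?_
  · rintro ⟨a, b⟩ h
    simp only [Finset.coe_sigma, Set.mem_sigma_iff, Finset.mem_coe, mem_nbrs] at h
    simpa using h.2
  · rintro ⟨a, b⟩ h ⟨c, d⟩ h' hcd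
    simp only [Finset.coe_sigma, Set.mem_sigma_iff, Finset.mem_coe, mem_nbrs] at h h'
    simp only [Sym2.eq_iff] at hcd
    rcases hcd with ⟨rfl, rfl⟩ | ⟨rfl, rfl⟩
    · rfl
    · exact absurd h.2 (hF _ h.1 _ h'.1)

theorem IsEar.nbrs_eq [DecidableEq V] (h : IsEar G v x y) : nbrs G v = {x, y} := by
  ext w
  simp only [mem_nbrs, Finset.mem_insert, Finset.mem_singleton]
  refine ⟨h.nbr w, ?_⟩
  rintro (rfl | rfl)
  exacts [h.left, h.right]

theorem IsEar.card_nbrs (h : IsEar G v x y) : (nbrs G v).card = 2 := by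
  classical
  rw [h.nbrs_eq, Finset.card_pair h.base.ne]

theorem mem_earSet : v ∈ earSet W G ↔ v ∈ W ∧ (nbrs G v).card = 2 := by
  simp [earSet]

namespace ReducedOn

theorem mem_earSet_of_isEar (h : ReducedOn W G) (hv : IsEar G v x y) : v ∈ earSet W G :=
  mem_earSet.2 ⟨h.mem_left hv.left, hv.card_nbrs⟩

/-- If `x` had degree two as well, join `v` to a vertex `t` off the triangle. The core through `vt`
contains `y`, directly or by way of `x`, and the other core cannot contain `x`; so the latter is
disjoint from the triangle `vxy`. -/
theorem notMem_earSet [DecidableEq V] (h : ReducedOn W G) (hW : 4 ≤ W.card) (hv : IsEar G v x y) :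
    x ∉ earSet W G := by
  intro hx
  obtain ⟨-, hx2⟩ := mem_earSet.1 hx
  have hxn : ∀ w, G.Adj x w → w = v ∨ w = y := by
    intro w hw
    have h1 : ({v, y} : Finset V) = nbrs G x := by
      refine Finset.eq_of_subset_of_card_le (fun t ht => ?_) ?_
      · simp only [Finset.mem_insert, Finset.mem_singleton] at ht
        rcases ht with rfl | rfl
        · exact mem_nbrs.2 hv.left.symm
        · exact mem_nbrs.2 hv.base
      · rw [hx2, Finset.card_pair hv.right.ne]
    have h2 := mem_nbrs.2 hw
    rw [← h1] at h2
    simpa using h2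
  obtain ⟨t, ht, h1⟩ : ∃ t ∈ W, t ∉ ({v, x, y} : Finset V) := by
    by_contra! hcon
    have := (Finset.card_le_card (s := W) (t := {v, x, y}) hcon).trans Finset.card_le_three
    omega
  simp only [Finset.mem_insert, Finset.mem_singleton, not_or] at h1
  obtain ⟨A, B, hAB, hvA, htA, hA, hB, -⟩ := h.exists_cores (h.mem_left hv.left) ht (Ne.symm h1.1)
    (fun ha => by have := hv.nbr t ha; tauto)
  have hd := Finset.disjoint_left.1 hAB
  have hyA : y ∈ A := by
    obtain ⟨a, ha, b, hb, hab, h2, h3⟩ := hA.2 v hvA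
    rw [sup_edge_adj_iff] at h2 h3
    have hx : x ∈ A → y ∈ A := fun hxA => (hA.mem_of_two (x := v) (y := y) hxA fun w hw => by
      rw [sup_edge_adj_iff] at hw
      have := hxn w
      have := hv.left.ne
      grind).2
    have := hv.nbr a
    have := hv.nbr b
    grind
  have hxB : x ∉ B := fun hxB => hd hvA (hB.mem_of_two hxB hxn).1
  refine h.free ⟨{v, x, y}, B, ?_, isCore_triangle hv.left hv.base hv.right, hB⟩
  rw [Finset.disjoint_left]
  intro s hs
  simp only [Finset.mem_insert, Finset.mem_singleton] at hs
  rcases hs with rfl | rfl | rfl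
  exacts [hd hvA, hxB, hd hyA]

/-- With disjoint bases the triangles of the two ears would be disjoint, because a base vertex is
never an ear. -/
theorem ear_inter [DecidableEq V] (h : ReducedOn W G) (hW : 4 ≤ W.card) (hv : IsEar G v x y) (hw : IsEar G w p q)
    (hvw : v ≠ w) : x = p ∨ x = q ∨ y = p ∨ y = q := by
  by_contra! hcon
  have h1 := h.mem_earSet_of_isEar hv
  have h2 := h.mem_earSet_of_isEar hw
  have h3 := h.notMem_earSet hW hv
  have h4 := h.notMem_earSet hW hv.swap
  have h5 := h.notMem_earSet hW hw
  have h6 := h.notMem_earSet hW hw.swap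
  exact not_triangles h.free hv.left hv.base hv.right hw.left hw.base hw.right hvw
    (fun e => h5 (e ▸ h1)) (fun e => h6 (e ▸ h1)) (fun e => h3 (e ▸ h2)) hcon.1 hcon.2.1
    (fun e => h4 (e ▸ h2)) hcon.2.2.1 hcon.2.2.2

theorem three_le (h : ReducedOn W G) (hu : u ∈ W) (hu' : u ∉ earSet W G) :
    3 ≤ (nbrs G u).card := by
  have := h.two_le u hu
  rw [mem_earSet] at hu'
  have : (nbrs G u).card ≠ 2 := fun h2 => hu' ⟨hu, h2⟩
  omega

/-- Vertices of `F` outside `S` are counted with degree three, at a deficit of one per ear; `S`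
collects the vertices whose actual degree is kept. -/
theorem sum_low [DecidableEq V] (h : ReducedOn W G) (hF : F ⊆ W) (hS : S ⊆ F) :
    ∑ u ∈ S, (nbrs G u).card + 3 * F.card ≤
      ∑ u ∈ F, (nbrs G u).card + 3 * S.card + (earSet W G ∩ (F \ S)).card := by
  have h1 : 3 * (F \ S).card ≤ ∑ u ∈ F \ S, (nbrs G u).card + (earSet W G ∩ (F \ S)).card := by
    rw [Finset.inter_comm, ← Finset.filter_mem_eq_inter, Finset.card_filter,
      ← Finset.sum_add_distrib, mul_comm, ← smul_eq_mul]
    refine Finset.card_nsmul_le_sum _ _ _ fun u hu => ?_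
    have huW := hF (Finset.sdiff_subset hu)
    by_cases hu' : u ∈ earSet W G
    · have := h.two_le u huW
      simp only [hu', if_true]
      omega
    · have := h.three_le huW hu'
      omega
  have h2 := Finset.sum_sdiff hS (f := fun u => (nbrs G u).card)
  have h3 := Finset.card_sdiff_add_card_eq_card hS
  omega

theorem two_mul_edges [DecidableEq V] (h : ReducedOn W G) (hS : S ⊆ W) :
    ∑ u ∈ S, (nbrs G u).card + 3 * W.card ≤
      2 * (edges G).card + 3 * S.card + (earSet W G \ S).card := by
  have h1 := h.sum_low subset_rfl hS
  rw [h.sum_card_nbrs] at h1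
  have h2 : (earSet W G ∩ (W \ S)).card ≤ (earSet W G \ S).card := Finset.card_le_card fun t ht => by
    simp only [Finset.mem_inter, Finset.mem_sdiff] at ht ⊢
    exact ⟨ht.1, ht.2.2⟩
  omega

/-- Counting with a triangle: the complement of a triangle is a forest. -/
theorem sum_compl_triangle [DecidableEq V] (h : ReducedOn W G) (hW : 4 ≤ W.card) (hxy : G.Adj x y)
    (hyz : G.Adj y z) (hxz : G.Adj x z) :
    ∑ u ∈ W \ {x, y, z}, (nbrs G u).card + 7 ≤ (edges G).card + W.card := by
  have hc : ({x, y, z} : Finset V).card = 3 :=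
    Finset.card_eq_three.2 ⟨x, y, z, hxy.ne, hxz.ne, hyz.ne, rfl⟩
  have hsub : ({x, y, z} : Finset V) ⊆ W := by
    intro t ht
    simp only [Finset.mem_insert, Finset.mem_singleton] at ht
    rcases ht with rfl | rfl | rfl
    exacts [h.mem_left hxy, h.mem_left hyz, h.mem_right hyz]
  have hcs := Finset.card_sdiff_add_card_eq_card hsub
  have key := sum_card_nbrs_le_of_not_isCore (G := G) (W \ {x, y, z})
    (Finset.card_pos.1 (by omega)) (fun A hA hcore => ?_) {s(x, y), s(y, z), s(x, z)} ?_ ?_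
  · have : ({s(x, y), s(y, z), s(x, z)} : Finset (Sym2 V)).card = 3 := by
      have := hxy.ne
      have := hyz.ne
      have := hxz.ne
      refine Finset.card_eq_three.2 ⟨_, _, _, ?_, ?_, ?_, rfl⟩ <;> simp only [ne_eq, Sym2.eq_iff] <;>
        tauto
    omega
  · refine h.free ⟨{x, y, z}, A, ?_, isCore_triangle hxy hyz hxz, hcore⟩
    exact (Finset.disjoint_sdiff).mono_right hA
  · intro e he
    simp only [Finset.mem_insert, Finset.mem_singleton] at he
    rcases he with rfl | rfl | rfl <;> simpa
  · intro e he v hv hve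
    simp only [Finset.mem_sdiff, Finset.mem_insert, Finset.mem_singleton] at he hv
    rcases he with rfl | rfl | rfl <;> · rw [Sym2.mem_iff] at hve; tauto

/-- Counting with an ear. -/
theorem sum_compl_ear [DecidableEq V] (h : ReducedOn W G) (hW : 4 ≤ W.card) (hv : IsEar G v x y)
    (hS : S ⊆ W \ {v, x, y}) :
    ∑ u ∈ S, (nbrs G u).card + 2 * W.card ≤
      (edges G).card + 3 * S.card + ((earSet W G).erase v \ S).card + 2 := by
  have h1 := h.sum_low Finset.sdiff_subset hS
  have h2 := h.sum_compl_triangle hW hv.left hv.base hv.right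
  have hc : ({v, x, y} : Finset V).card = 3 :=
    Finset.card_eq_three.2 ⟨v, x, y, hv.left.ne, hv.right.ne, hv.base.ne, rfl⟩
  have hsub : ({v, x, y} : Finset V) ⊆ W := by
    intro t ht
    simp only [Finset.mem_insert, Finset.mem_singleton] at ht
    rcases ht with rfl | rfl | rfl
    exacts [h.mem_left hv.left, h.mem_right hv.left, h.mem_right hv.right]
  have hcs := Finset.card_sdiff_add_card_eq_card hsub
  have h3 : (earSet W G ∩ ((W \ {v, x, y}) \ S)).card ≤ ((earSet W G).erase v \ S).card := by
    refine Finset.card_le_card fun t ht => ?_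
    simp only [Finset.mem_inter, Finset.mem_sdiff, Finset.mem_insert, Finset.mem_singleton,
      Finset.mem_erase] at ht ⊢
    tauto
  omega

/-- Off the triangle of `v` all degrees are at least three except at the other ears, and these
vertices span a forest. -/
theorem two_mul_card_le [DecidableEq V] (h : ReducedOn W G) (hW : 4 ≤ W.card) (hv : IsEar G v x y) :
    2 * W.card ≤ (edges G).card + (earSet W G).card + 1 := by
  have h1 := h.sum_compl_ear hW hv (Finset.empty_subset _)
  have h2 := Finset.card_erase_add_one (h.mem_earSet_of_isEar hv)
  simp only [Finset.sum_empty, Finset.card_empty, Finset.sdiff_empty] at h1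
  omega

end ReducedOn
end Ears

/-! ### Reduced graphs without ears -/

section Cases
variable {V : Type} [Fintype V] [DecidableEq V] {G : SimpleGraph V} {W : Finset V}

namespace ReducedOn

/-- The complement of the four-cycle spans a forest; the four cycle edges are the reserved ones, and
all degrees are at least three. -/
theorem edges_ge_of_four_cycle (h : ReducedOn W G) (h0 : earSet W G = ∅) (hW : 5 ≤ W.card)
    {a b c d : V} (hab : G.Adj a b) (hbc : G.Adj b c) (hcd : G.Adj c d) (hda : G.Adj d a)
    (hac : a ≠ c) (hbd : b ≠ d) : 2 * W.card ≤ (edges G).card + 3 := by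
  have n1 := hab.ne
  have n2 := hbc.ne
  have n3 := hcd.ne
  have n4 := hda.ne
  have hc : ({a, b, c, d} : Finset V).card = 4 := by
    rw [Finset.card_insert_of_notMem, Finset.card_insert_of_notMem, Finset.card_insert_of_notMem,
      Finset.card_singleton] <;> simp only [Finset.mem_insert, Finset.mem_singleton] <;> grind
  have hsub : ({a, b, c, d} : Finset V) ⊆ W := by
    intro t ht
    simp only [Finset.mem_insert, Finset.mem_singleton] at ht
    rcases ht with rfl | rfl | rfl | rfl
    exacts [h.mem_left hab, h.mem_left hbc, h.mem_left hcd, h.mem_left hda]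
  have hcs := Finset.card_sdiff_add_card_eq_card hsub
  have hcore : IsCore G {a, b, c, d} := by
    refine ⟨⟨a, by simp⟩, fun t ht => ?_⟩
    simp only [Finset.mem_insert, Finset.mem_singleton] at ht
    rcases ht with rfl | rfl | rfl | rfl
    exacts [⟨b, by simp, d, by simp, hbd, hab, hda.symm⟩,
      ⟨a, by simp, c, by simp, hac, hab.symm, hbc⟩,
      ⟨b, by simp, d, by simp, hbd, hbc.symm, hcd⟩,
      ⟨a, by simp, c, by simp, hac, hda, hcd.symm⟩]
  have key := sum_card_nbrs_le_of_not_isCore (G := G) (W \ {a, b, c, d})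
    (Finset.card_pos.1 (by omega)) (fun A hA hA' => ?_) {s(a, b), s(b, c), s(c, d), s(d, a)} ?_ ?_
  · have h4 : ({s(a, b), s(b, c), s(c, d), s(d, a)} : Finset (Sym2 V)).card = 4 := by
      rw [Finset.card_insert_of_notMem, Finset.card_insert_of_notMem, Finset.card_insert_of_notMem,
        Finset.card_singleton] <;>
      simp only [Finset.mem_insert, Finset.mem_singleton, Sym2.eq_iff] <;> grind
    have h5 := h.sum_low (F := W \ {a, b, c, d}) Finset.sdiff_subset (Finset.empty_subset _)
    rw [h0] at h5
    simp only [Finset.sum_empty, Finset.card_empty, Finset.empty_inter] at h5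
    omega
  · exact h.free ⟨_, A, Finset.disjoint_sdiff.mono_right hA, hcore, hA'⟩
  · intro e he
    simp only [Finset.mem_insert, Finset.mem_singleton] at he
    rcases he with rfl | rfl | rfl | rfl <;> simpa
  · intro e he v hv hve
    simp only [Finset.mem_sdiff, Finset.mem_insert, Finset.mem_singleton] at he hv
    rcases he with rfl | rfl | rfl | rfl <;> · rw [Sym2.mem_iff] at hve; tauto

theorem edges_ge_of_earSet_eq_empty (h : ReducedOn W G) (h0 : earSet W G = ∅) (hW : 7 ≤ W.card) :
    W.card + 5 ≤ (edges G).card := by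
  have hdeg : ∀ u ∈ W, 3 ≤ (nbrs G u).card := fun u hu => h.three_le hu (by simp [h0])
  by_cases htri : ∃ x y z, G.Adj x y ∧ G.Adj y z ∧ G.Adj x z
  · obtain ⟨x, y, z, hxy, hyz, hxz⟩ := htri
    have h1 := h.sum_compl_triangle (by omega) hxy hyz hxz
    have h2 := h.sum_low (F := W \ {x, y, z}) Finset.sdiff_subset (Finset.empty_subset _)
    rw [h0] at h2
    simp only [Finset.sum_empty, Finset.card_empty, Finset.empty_inter] at h2
    have h3 := Finset.le_card_sdiff {x, y, z} W
    have h4 := Finset.card_le_three (a := x) (b := y) (c := z)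
    omega
  push Not at htri
  have hsum : ∀ S ⊆ W, _ := fun S hS => h.two_mul_edges (S := S) hS
  simp only [h0, Finset.empty_sdiff, Finset.card_empty] at hsum
  have hind : ∀ z, ∀ u ∈ nbrs G z, ∀ v ∈ nbrs G z, ¬ G.Adj u v := fun z u hu v hv huv =>
    htri z u v (mem_nbrs.1 hu) huv (mem_nbrs.1 hv)
  -- Here `2e ≥ 3n` is enough; for `n = 9` this needs rounding `27 / 2` up to `14`.
  by_cases h9 : 9 ≤ W.card
  · have := hsum ∅ (Finset.empty_subset _)
    simp only [Finset.sum_empty, Finset.card_empty] at this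
    omega
  by_contra hlt
  -- On eight vertices a four-cycle already yields 13 edges. Without triangles and four-cycles,
  -- three neighbours of `v` each have two further neighbours, six distinct vertices where at most
  -- four remain.
  by_cases h8 : W.card = 8
  · obtain ⟨v, hv⟩ : W.Nonempty := Finset.card_pos.1 (by omega)
    have hv3 := hdeg v hv
    set R := W \ insert v (nbrs G v) with hR
    have hRc : R.card ≤ 4 := by
      have h1 : insert v (nbrs G v) ⊆ W := by
        intro t ht
        rw [Finset.mem_insert, mem_nbrs] at ht
        rcases ht with rfl | ht
        exacts [hv, h.mem_right ht]
      have h2 := Finset.card_sdiff_add_card_eq_card h1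
      rw [Finset.card_insert_of_notMem (by simp), ← hR] at h2
      omega
    obtain ⟨T, hT, hT3⟩ := Finset.exists_subset_card_eq hv3
    obtain ⟨a, b, c, hab, hac, hbc, rfl⟩ := Finset.card_eq_three.1 hT3
    have hav : ∀ t ∈ ({a, b, c} : Finset V), (nbrs G t ∩ R).card ≥ 2 := by
      intro t ht
      have htv := hT ht
      have h1 : (nbrs G t).erase v ⊆ nbrs G t ∩ R := by
        intro s hs
        simp only [Finset.mem_erase, mem_nbrs] at hs
        simp only [hR, Finset.mem_inter, mem_nbrs, Finset.mem_sdiff, Finset.mem_insert, not_or]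
        exact ⟨hs.2, h.mem_right hs.2, hs.1, fun hvs => hind v t htv s (by simpa) hs.2⟩
      have h2 := Finset.card_le_card h1
      have h3 := hdeg t (h.mem_right (mem_nbrs.1 htv))
      have h4 := Finset.pred_card_le_card_erase (s := nbrs G t) (a := v)
      omega
    have hpair : ∀ s ∈ ({a, b, c} : Finset V), ∀ t ∈ ({a, b, c} : Finset V), s ≠ t →
        ∀ w ∈ nbrs G s ∩ R, w ∉ nbrs G t ∩ R := by
      intro s hs t ht hst w hw hw'
      simp only [hR, Finset.mem_inter, mem_nbrs, Finset.mem_sdiff, Finset.mem_insert, not_or]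
        at hw hw'
      have := h.edges_ge_of_four_cycle h0 (by omega) (mem_nbrs.1 (hT hs)) hw.1 hw'.1.symm
        (mem_nbrs.1 (hT ht)).symm (Ne.symm hw.2.2.1) hst
      omega
    have d1 : Disjoint (nbrs G a ∩ R) (nbrs G b ∩ R) :=
      Finset.disjoint_left.2 (hpair a (by simp) b (by simp) hab)
    have d2 : Disjoint (nbrs G a ∩ R ∪ nbrs G b ∩ R) (nbrs G c ∩ R) :=
      Finset.disjoint_union_left.2 ⟨Finset.disjoint_left.2 (hpair a (by simp) c (by simp) hac),
        Finset.disjoint_left.2 (hpair b (by simp) c (by simp) hbc)⟩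
    have h1 := Finset.card_union_of_disjoint d1
    have h2 := Finset.card_union_of_disjoint d2
    have h3 : nbrs G a ∩ R ∪ nbrs G b ∩ R ∪ nbrs G c ∩ R ⊆ R := by
      refine Finset.union_subset (Finset.union_subset ?_ ?_) ?_ <;> exact Finset.inter_subset_right
    have h4 := Finset.card_le_card h3
    have := hav a (by simp)
    have := hav b (by simp)
    have := hav c (by simp)
    omega
  · have h7 : W.card = 7 := by omega
    by_cases h4 : ∃ z ∈ W, 4 ≤ (nbrs G z).card
    · obtain ⟨z, hz, hz4⟩ := h4
      have h1 := sum_card_nbrs_le_of_isIndep (hind z)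
      have h2 : (nbrs G z).card • 3 ≤ ∑ v ∈ nbrs G z, (nbrs G v).card :=
        Finset.card_nsmul_le_sum _ _ _ fun u hu => hdeg u (h.mem_right (mem_nbrs.1 hu))
      rw [smul_eq_mul] at h2
      omega
    · push Not at h4
      have h1 := h.sum_card_nbrs
      have h2 : ∑ v ∈ W, (nbrs G v).card = ∑ v ∈ W, 3 := Finset.sum_congr rfl fun v hv => by
        have := h4 v hv
        have := hdeg v hv
        omega
      rw [h2, Finset.sum_const, smul_eq_mul] at h1
      omega

end ReducedOn
end Cases

/-! ### Ears on the three sides of a triangle -/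

section Cases
variable {V : Type} [Fintype V] {G : SimpleGraph V} {W : Finset V} {u v w x y z : V}

theorem nbrs_subset_of_card {S : Finset V} {n : ℕ} (hS : ∀ t ∈ S, G.Adj v t) (hn : S.card = n)
    (hv : (nbrs G v).card ≤ n) : ∀ t, G.Adj v t → t ∈ S := by
  intro t ht
  have h1 : S = nbrs G v :=
    Finset.eq_of_subset_of_card_le (fun s hs => mem_nbrs.2 (hS s hs)) (by omega)
  rw [h1]
  exact mem_nbrs.2 ht

theorem card_le_of_nbrs_subset {S : Finset V} (hS : ∀ t, G.Adj v t → t ∈ S) :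
    (nbrs G v).card ≤ S.card :=
  Finset.card_le_card fun t ht => hS t (mem_nbrs.1 ht)

namespace ReducedOn

/-- Three ears sitting on the three sides of a triangle. -/
theorem edges_ge_of_triangle_ears [DecidableEq V] (h : ReducedOn W G) (hW : 7 ≤ W.card) {a b c : V}
    (ha : IsEar G a y z) (hb : IsEar G b x z) (hc : IsEar G c x y) :
    W.card + 5 ≤ (edges G).card := by
  have hW4 : 4 ≤ W.card := by omega
  have nx := h.notMem_earSet hW4 hb
  have ny := h.notMem_earSet hW4 ha
  have nz := h.notMem_earSet hW4 ha.swap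
  have ma := h.mem_earSet_of_isEar ha
  have mb := h.mem_earSet_of_isEar hb
  have mc := h.mem_earSet_of_isEar hc
  have exy := hc.base.ne
  have eyz := ha.base.ne
  have exz := hb.base.ne
  have hne : ∀ s ∈ earSet W G, s ≠ x ∧ s ≠ y ∧ s ≠ z := fun s hs =>
    ⟨fun e => nx (e ▸ hs), fun e => ny (e ▸ hs), fun e => nz (e ▸ hs)⟩
  have hab : a ≠ b := by
    rintro rfl
    have := ha.nbr x hb.left
    tauto
  have hac : a ≠ c := by
    rintro rfl
    have := ha.nbr x hc.left
    tauto
  have hbc : b ≠ c := by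
    rintro rfl
    have := hb.nbr y hc.right
    tauto
  -- The base of a fourth ear would meet all three sides of the triangle `xyz`, so it would be a
  -- side and its ear a twin.
  have hD : earSet W G = {a, b, c} := by
    ext d
    simp only [Finset.mem_insert, Finset.mem_singleton]
    constructor
    · intro hd
      by_contra! hcon
      obtain ⟨p, q, hd'⟩ := h.exists_ear d (mem_earSet.1 hd).1 (mem_earSet.1 hd).2
      have i1 := h.ear_inter hW4 hd' ha hcon.1
      have i2 := h.ear_inter hW4 hd' hb hcon.2.1
      have i3 := h.ear_inter hW4 hd' hc hcon.2.2
      have hpq := hd'.base.ne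
      have j : (p = y ∧ q = z) ∨ (p = z ∧ q = y) ∨ (p = x ∧ q = z) ∨ (p = z ∧ q = x) ∨
          (p = x ∧ q = y) ∨ (p = y ∧ q = x) := by
        clear hcon
        grind
      rcases j with ⟨rfl, rfl⟩ | ⟨rfl, rfl⟩ | ⟨rfl, rfl⟩ | ⟨rfl, rfl⟩ | ⟨rfl, rfl⟩ | ⟨rfl, rfl⟩
      exacts [hcon.1 (h.twin _ _ _ _ hd' ha), hcon.1 (h.twin _ _ _ _ hd'.swap ha),
        hcon.2.1 (h.twin _ _ _ _ hd' hb), hcon.2.1 (h.twin _ _ _ _ hd'.swap hb),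
        hcon.2.2 (h.twin _ _ _ _ hd' hc), hcon.2.2 (h.twin _ _ _ _ hd'.swap hc)]
    · rintro (rfl | rfl | rfl) <;> assumption
  have hD3 : (earSet W G).card = 3 := by
    rw [hD]
    exact Finset.card_eq_three.2 ⟨a, b, c, hab, hac, hbc, rfl⟩
  have h2n := h.two_mul_card_le hW4 ha
  have hT3 : ({x, y, z} : Finset V).card = 3 := Finset.card_eq_three.2 ⟨x, y, z, exy, exz, eyz, rfl⟩
  have hTW : ({x, y, z} : Finset V) ⊆ W := by
    intro t ht
    simp only [Finset.mem_insert, Finset.mem_singleton] at ht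
    rcases ht with rfl | rfl | rfl
    exacts [h.mem_right hb.left, h.mem_right ha.left, h.mem_right ha.right]
  have hsum := h.two_mul_edges hTW
  rw [Finset.sum_insert (by simp [exy, exz]), Finset.sum_insert (by simp [eyz]),
    Finset.sum_singleton, hT3] at hsum
  have hDle := Finset.card_le_card (Finset.sdiff_subset (s := earSet W G) (t := {x, y, z}))
  rw [hD3] at hDle
  have hna := hne a ma
  have hnb := hne b mb
  have hnc := hne c mc
  have hcard4 : ∀ {p q r s : V}, p ≠ q → p ≠ r → p ≠ s → q ≠ r → q ≠ s → r ≠ s →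
      ({p, q, r, s} : Finset V).card = 4 := by
    intro p q r s h1 h2 h3 h4 h5 h6
    rw [Finset.card_insert_of_notMem (by simp [h1, h2, h3]),
      Finset.card_insert_of_notMem (by simp [h4, h5]), Finset.card_pair h6]
  have dx : ∀ t ∈ ({b, c, y, z} : Finset V), G.Adj x t := by
    simp only [Finset.mem_insert, Finset.mem_singleton]
    rintro t (rfl | rfl | rfl | rfl)
    exacts [hb.left.symm, hc.left.symm, hc.base, hb.base]
  have dy : ∀ t ∈ ({a, c, x, z} : Finset V), G.Adj y t := by
    simp only [Finset.mem_insert, Finset.mem_singleton]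
    rintro t (rfl | rfl | rfl | rfl)
    exacts [ha.left.symm, hc.right.symm, hc.base.symm, ha.base]
  have dz : ∀ t ∈ ({a, b, x, y} : Finset V), G.Adj z t := by
    simp only [Finset.mem_insert, Finset.mem_singleton]
    rintro t (rfl | rfl | rfl | rfl)
    exacts [ha.right.symm, hb.right.symm, hb.base.symm, ha.base.symm]
  have cx : ({b, c, y, z} : Finset V).card = 4 := hcard4 hbc hnb.2.1 hnb.2.2 hnc.2.1 hnc.2.2 eyz
  have cy : ({a, c, x, z} : Finset V).card = 4 := hcard4 hac hna.1 hna.2.2 hnc.1 hnc.2.2 exz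
  have cz : ({a, b, x, y} : Finset V).card = 4 := hcard4 hab hna.1 hna.2.1 hnb.1 hnb.2.1 exy
  have gx : 4 ≤ (nbrs G x).card := cx ▸ Finset.card_le_card fun t ht => mem_nbrs.2 (dx t ht)
  have gy : 4 ≤ (nbrs G y).card := cy ▸ Finset.card_le_card fun t ht => mem_nbrs.2 (dy t ht)
  have gz : 4 ≤ (nbrs G z).card := cz ▸ Finset.card_le_card fun t ht => mem_nbrs.2 (dz t ht)
  -- With at most `n + 4` edges, `h2n` forces `n ≤ 8`.
  by_contra hlt
  set T : Finset V := {x, y, z} ∪ earSet W G with hT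
  have hTc : T.card = 6 := by
    rw [hT, Finset.card_union_of_disjoint, hT3, hD3]
    rw [Finset.disjoint_left]
    intro t ht hte
    have := hne t hte
    simp only [Finset.mem_insert, Finset.mem_singleton] at ht
    tauto
  have hTW' : T ⊆ W := Finset.union_subset hTW fun t ht => (mem_earSet.1 ht).1
  have hrest := Finset.card_sdiff_add_card_eq_card hTW'
  obtain ⟨u, hu⟩ : (W \ T).Nonempty := Finset.card_pos.1 (by omega)
  have hu' := Finset.mem_sdiff.1 hu
  rw [hT, hD] at hu'
  simp only [Finset.mem_union, Finset.mem_insert, Finset.mem_singleton, not_or] at hu'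
  obtain ⟨huW, ⟨hux, huy, huz⟩, hua, hub, huc⟩ := hu'
  have hu3 := h.three_le huW (by simp [hD, hua, hub, huc])
  have hun : ∀ t, G.Adj u t → t ≠ a ∧ t ≠ b ∧ t ≠ c := by
    intro t ht
    refine ⟨?_, ?_, ?_⟩
    · rintro rfl
      have := ha.nbr u ht.symm
      tauto
    · rintro rfl
      have := hb.nbr u ht.symm
      tauto
    · rintro rfl
      have := hc.nbr u ht.symm
      tauto
  have hmem : ∀ t, G.Adj u t → t ∈ ({x, y, z} : Finset V) ∪ (W \ T).erase u := by
    intro t ht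
    have h1 := hun t ht
    have h2 := h.mem_right ht
    have h3 := ht.ne
    simp only [hT, hD, Finset.mem_union, Finset.mem_insert, Finset.mem_singleton, Finset.mem_erase,
      Finset.mem_sdiff]
    tauto
  have hcu := Finset.card_erase_add_one hu
  -- For `n = 7` the one remaining vertex is joined to `x`, `y` and `z`, whose degrees rise to five:
  -- too many edges.
  by_cases h7 : W.card = 7
  · have he : (W \ T).erase u = ∅ := Finset.card_eq_zero.1 (by omega)
    rw [he, Finset.union_empty] at hmem
    have heq : nbrs G u = {x, y, z} :=
      Finset.eq_of_subset_of_card_le (fun t ht => hmem t (mem_nbrs.1 ht)) (by omega)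
    have ax : G.Adj u x := mem_nbrs.1 (by simp [heq])
    have ay : G.Adj u y := mem_nbrs.1 (by simp [heq])
    have az : G.Adj u z := mem_nbrs.1 (by simp [heq])
    have five : ∀ (t : V) (S : Finset V), (∀ s ∈ S, G.Adj t s) → S.card = 4 → u ∉ S → G.Adj u t →
        5 ≤ (nbrs G t).card := by
      intro t S hS hS4 huS hut
      have : (insert u S).card ≤ (nbrs G t).card := Finset.card_le_card fun s hs => by
        rw [mem_nbrs]
        rcases Finset.mem_insert.1 hs with rfl | hs
        exacts [hut.symm, hS s hs]
      rw [Finset.card_insert_of_notMem huS] at this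
      omega
    have := five x _ dx cx (by simp [hub, huc, huy, huz]) ax
    have := five y _ dy cy (by simp [hua, huc, hux, huz]) ay
    have := five z _ dz cz (by simp [hua, hub, hux, huy]) az
    omega
  -- The degree count is now tight, so `x`, `y`, `z` have no neighbours beyond the four known ones,
  -- and `u` keeps only one possible neighbour.
  · have h8 : W.card = 8 := by omega
    have hux' : ¬ G.Adj u x := fun hadj => by
      have := nbrs_subset_of_card dx cx (by omega) u hadj.symm
      simp [hub, huc, huy, huz] at this
    have huy' : ¬ G.Adj u y := fun hadj => by
      have := nbrs_subset_of_card dy cy (by omega) u hadj.symm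
      simp [hua, huc, hux, huz] at this
    have huz' : ¬ G.Adj u z := fun hadj => by
      have := nbrs_subset_of_card dz cz (by omega) u hadj.symm
      simp [hua, hub, hux, huy] at this
    have := card_le_of_nbrs_subset (S := (W \ T).erase u) fun t ht => by
      have h1 := hmem t ht
      rw [Finset.mem_union] at h1
      refine h1.resolve_left fun h2 => ?_
      simp only [Finset.mem_insert, Finset.mem_singleton] at h2
      rcases h2 with rfl | rfl | rfl <;> tauto
    omega

end ReducedOn
end Cases

/-! ### Ears sharing a base vertex: the saturation arguments -/

section Star
variable {V : Type} [Fintype V] [DecidableEq V] {G : SimpleGraph V} {W : Finset V} {x : V}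
  {y : V → V}

namespace ReducedOn

/-- Join `a` to `b`. If the other core `B` contains `x`, then `A` passes through `y a`, `y b` and,
these being non-adjacent, `y c`, so that only `x` and `c` are left for `B`. If `B` misses `x`, it
also misses `y a` and `y b`, which have at most one usable neighbour, and only `c` and `y c` remain.
-/
theorem star_adj (h : ReducedOn W G) (hy : ∀ v ∈ earSet W G, IsEar G v x (y v)) {a b c : V}
    (ha : a ∈ earSet W G) (hb : b ∈ earSet W G) (hc : c ∈ earSet W G) (hab : a ≠ b)
    (hx : x ∉ earSet W G) (hyD : ∀ v ∈ earSet W G, y v ∉ earSet W G) (hpq : y a ≠ y b) (hpr : y a ≠ y c) (hqr : y b ≠ y c)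
    (hW : ∀ t ∈ W, t = x ∨ t = a ∨ t = b ∨ t = c ∨ t = y a ∨ t = y b ∨ t = y c) :
    G.Adj (y a) (y b) := by
  by_contra hadj
  have ea := hy a ha
  have eb := hy b hb
  have ec := hy c hc
  have na : ∀ t, G.Adj (y a) t → t = x ∨ t = a ∨ t = y c := by
    intro t ht
    have h1 := hW t (h.mem_right ht)
    have h2 := eb.nbr (y a)
    have h3 := ec.nbr (y a)
    have h4 := ea.base.ne
    have h5 := ht.symm
    have h6 := ht.ne
    rcases h1 with rfl | rfl | rfl | rfl | rfl | rfl | rfl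
    · tauto
    · tauto
    · have := h2 h5; tauto
    · have := h3 h5; grind
    · tauto
    · tauto
    · tauto
  have nb : ∀ t, G.Adj (y b) t → t = x ∨ t = b ∨ t = y c := by
    intro t ht
    have h1 := hW t (h.mem_right ht)
    have h2 := ea.nbr (y b)
    have h3 := ec.nbr (y b)
    have h4 := eb.base.ne
    have h5 := ht.symm
    have h6 := ht.ne
    rcases h1 with rfl | rfl | rfl | rfl | rfl | rfl | rfl
    · tauto
    · have := h2 h5; grind
    · tauto
    · have := h3 h5; grind
    · tauto
    · tauto
    · tauto
  have hax : ¬ G.Adj a b := fun hadj' => by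
    have := ea.nbr b hadj'
    rcases this with rfl | rfl
    · exact hx hb
    · exact hyD a ha hb
  obtain ⟨A, B, hAB, haA, hbA, hA, hB, hAW, hBW⟩ :=
    h.exists_cores (h.mem_left ea.left) (h.mem_left eb.left) hab hax
  have hd := Finset.disjoint_left.1 hAB
  have hya : y a ≠ a := ea.right.ne'
  have hyb : y b ≠ b := eb.right.ne'
  have hyab : y a ≠ b := fun e => hyD a ha (e ▸ hb)
  have hyba : y b ≠ a := fun e => hyD b hb (e ▸ ha)
  by_cases hxB : x ∈ B
  · have hxA : x ∉ A := fun hxA => hd hxA hxB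
    have pA : y a ∈ A := by
      obtain ⟨s, hs, t, ht, hst, h1, h2⟩ := hA.2 a haA
      rw [sup_edge_adj_iff] at h1 h2
      have := ea.nbr s
      have := ea.nbr t
      grind
    have qA : y b ∈ A := by
      obtain ⟨s, hs, t, ht, hst, h1, h2⟩ := hA.2 b hbA
      rw [sup_edge_adj_iff] at h1 h2
      have := eb.nbr s
      have := eb.nbr t
      grind
    have rA : y c ∈ A := by
      obtain ⟨s, hs, t, ht, hst, h1, h2⟩ := hA.2 _ pA
      rw [sup_edge_adj_iff] at h1 h2
      have := na s
      have := na t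
      grind
    refine hB.not_subset_pair (u := x) (v := c) fun t ht => ?_
    have := hW t (hBW ht)
    have h1 : t ∉ A := fun hA => hd hA ht
    simp only [Finset.mem_insert, Finset.mem_singleton]
    grind
  · have aB := hd haA
    have bB := hd hbA
    have cB : c ∉ B := fun hcB => hxB (hB.mem_of_two hcB ec.nbr).1
    have pB : y a ∉ B := fun hp => by
      obtain ⟨s, hs, t, ht, hst, h1, h2⟩ := hB.2 _ hp
      have := na s h1
      have := na t h2
      grind
    have qB : y b ∉ B := fun hp => by
      obtain ⟨s, hs, t, ht, hst, h1, h2⟩ := hB.2 _ hp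
      have := nb s h1
      have := nb t h2
      grind
    refine hB.not_subset_pair (u := y c) (v := c) fun t ht => ?_
    have := hW t (hBW ht)
    simp only [Finset.mem_insert, Finset.mem_singleton]
    grind

/-- Join `a` to `b`. If the other core `B` contains `x`, then `B = {x, u, w}` and `p`, `q` are
adjacent; their degrees are exhausted and `u` has at most the neighbours `x`, `w`. If `B` misses
`x`, the degree bounds keep `p` and `q` out of `B` as well, leaving only `u` and `w`. -/
theorem false_of_two_ears (h : ReducedOn W G) {a b p q u w : V} (ha : IsEar G a x p)
    (hb : IsEar G b x q) (hab : a ≠ b) (hax : ¬ G.Adj a b) (hpb : p ≠ b) (hqa : q ≠ a)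
    (hpq : p ≠ q)
    (hux : u ≠ x) (hup : u ≠ p) (huq : u ≠ q) (hw : w ≠ p ∧ w ≠ q)
    (hW : ∀ t ∈ W, t = x ∨ t = a ∨ t = b ∨ t = p ∨ t = q ∨ t = u ∨ t = w)
    (dp : (nbrs G p).card ≤ 3) (dq : (nbrs G q).card ≤ 3) (du : 3 ≤ (nbrs G u).card) : False := by
  have np : ∀ s, G.Adj p s → s ≠ x → s ≠ a → ∀ t, G.Adj p t → t = x ∨ t = a ∨ t = s := by
    intro s hs hsx hsa t ht
    have hc : ({x, a, s} : Finset V).card = 3 :=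
      Finset.card_eq_three.2 ⟨x, a, s, ha.left.ne', hsx.symm, hsa.symm, rfl⟩
    have := nbrs_subset_of_card (v := p) (S := {x, a, s}) (fun r hr => by
      simp only [Finset.mem_insert, Finset.mem_singleton] at hr
      rcases hr with rfl | rfl | rfl
      exacts [ha.base.symm, ha.right.symm, hs]) hc dp t ht
    simpa using this
  have nq : ∀ s, G.Adj q s → s ≠ x → s ≠ b → ∀ t, G.Adj q t → t = x ∨ t = b ∨ t = s := by
    intro s hs hsx hsa t ht
    have hc : ({x, b, s} : Finset V).card = 3 :=
      Finset.card_eq_three.2 ⟨x, b, s, hb.left.ne', hsx.symm, hsa.symm, rfl⟩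
    have := nbrs_subset_of_card (v := q) (S := {x, b, s}) (fun r hr => by
      simp only [Finset.mem_insert, Finset.mem_singleton] at hr
      rcases hr with rfl | rfl | rfl
      exacts [hb.base.symm, hb.right.symm, hs]) hc dq t ht
    simpa using this
  obtain ⟨A, B, hAB, haA, hbA, hA, hB, hAW, hBW⟩ :=
    h.exists_cores (h.mem_left ha.left) (h.mem_left hb.left) hab hax
  have hd := Finset.disjoint_left.1 hAB
  by_cases hxB : x ∈ B
  · have hxA : x ∉ A := fun hxA => hd hxA hxB
    have pA : p ∈ A := by
      obtain ⟨s, hs, t, ht, hst, h1, h2⟩ := hA.2 a haA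
      rw [sup_edge_adj_iff] at h1 h2
      have := ha.nbr s
      have := ha.nbr t
      grind
    have qA : q ∈ A := by
      obtain ⟨s, hs, t, ht, hst, h1, h2⟩ := hA.2 b hbA
      rw [sup_edge_adj_iff] at h1 h2
      have := hb.nbr s
      have := hb.nbr t
      grind
    have hBsub : B ⊆ {x, u, w} := fun t ht => by
      have := hW t (hBW ht)
      have h1 : t ∉ A := fun hA => hd hA ht
      simp only [Finset.mem_insert, Finset.mem_singleton]
      grind
    have hBeq : B = {x, u, w} :=
      Finset.eq_of_subset_of_card_le hBsub (Finset.card_le_three.trans hB.three_le_card)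
    have huB : u ∉ A := fun hu => hd hu (by simp [hBeq])
    have hwB : w ∉ A := fun hu => hd hu (by simp [hBeq])
    have hpA : ∀ s ∈ A, s ≠ a → (G ⊔ edge a b).Adj p s → s = b ∨ s = q := by
      intro s hs hsa hps
      rcases hW s (hAW hs) with e | e | e | e | e | e | e
      exacts [(hxA (e ▸ hs)).elim, (hsa e).elim, Or.inl e, (hps.ne e.symm).elim, Or.inr e,
        (huB (e ▸ hs)).elim, (hwB (e ▸ hs)).elim]
    have hpa : p ≠ a := ha.right.ne'
    have hpb' : ¬ G.Adj p b := fun hadj => (hb.nbr p hadj.symm).elim ha.base.ne' hpq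
    have hpq' : G.Adj p q := by
      obtain ⟨s, hs, hsa, h1⟩ : ∃ s ∈ A, s ≠ a ∧ (G ⊔ edge a b).Adj p s := by
        obtain ⟨s, hs, t, ht, hst, h1, h2⟩ := hA.2 p pA
        by_cases hsa : s = a
        · exact ⟨t, ht, fun e => hst (hsa.trans e.symm), h2⟩
        · exact ⟨s, hs, hsa, h1⟩
      have h2 := hpA s hs hsa h1
      rw [sup_edge_adj_iff] at h1
      rcases h1 with h1 | ⟨-, ⟨e, -⟩ | ⟨e, -⟩⟩
      · rcases h2 with rfl | rfl
        exacts [(hpb' h1).elim, h1]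
      exacts [(hpa e).elim, (hpb e).elim]
    have h1 := np q hpq' hb.base.ne' hqa
    have h2 := nq p hpq'.symm ha.base.ne' hpb
    have hua : u ≠ a := fun e => huB (e ▸ haA)
    have hub : u ≠ b := fun e => huB (e ▸ hbA)
    have := card_le_of_nbrs_subset (v := u) (S := {x, w}) fun t ht => by
      have h3 := hW t (h.mem_right ht)
      have h9 := ht.symm
      simp only [Finset.mem_insert, Finset.mem_singleton]
      rcases h3 with e | e | e | e | e | e | e
      · exact Or.inl e
      · exact ((ha.nbr u (e ▸ h9)).elim hux hup).elim
      · exact ((hb.nbr u (e ▸ h9)).elim hux huq).elim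
      · exact ((h1 u (e ▸ h9)).elim hux fun e => e.elim hua huq).elim
      · exact ((h2 u (e ▸ h9)).elim hux fun e => e.elim hub hup).elim
      · exact absurd e.symm ht.ne
      · exact Or.inr e
    have := this.trans Finset.card_le_two
    omega
  · have aB := hd haA
    have bB := hd hbA
    have pB : p ∉ B := fun hp => by
      obtain ⟨s, hs, t, ht, hst, h1, h2⟩ := hB.2 _ hp
      have := np s h1 (fun e => hxB (e ▸ hs)) (fun e => aB (e ▸ hs)) t h2
      grind
    have qB : q ∉ B := fun hp => by
      obtain ⟨s, hs, t, ht, hst, h1, h2⟩ := hB.2 _ hp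
      have := nq s h1 (fun e => hxB (e ▸ hs)) (fun e => bB (e ▸ hs)) t h2
      grind
    refine hB.not_subset_pair (u := u) (v := w) fun t ht => ?_
    have := hW t (hBW ht)
    simp only [Finset.mem_insert, Finset.mem_singleton]
    grind

end ReducedOn
end Star

/-! ### Ears sharing a base vertex: the count -/

section Final
variable {V : Type} [Fintype V] [DecidableEq V] {G : SimpleGraph V} {W : Finset V} {x : V}
  {y : V → V}

namespace ReducedOn

set_option maxHeartbeats 1000000 in
theorem edges_ge_of_star (h : ReducedOn W G) (hW : 7 ≤ W.card)
    (hy : ∀ v ∈ earSet W G, IsEar G v x (y v)) (hk : 2 ≤ (earSet W G).card) :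
    W.card + 5 ≤ (edges G).card := by
  have hW4 : 4 ≤ W.card := by omega
  have hDW : earSet W G ⊆ W := fun t ht => (mem_earSet.1 ht).1
  have hyD : ∀ v ∈ earSet W G, y v ∉ earSet W G := fun v hv => h.notMem_earSet hW4 (hy v hv).swap
  have hyx : ∀ v ∈ earSet W G, x ≠ y v := fun v hv => (hy v hv).base.ne
  have hinj : Set.InjOn y (earSet W G) := fun v hv w hw e =>
    h.twin v w x (y v) (hy v hv) (e ▸ hy w hw)
  obtain ⟨v₀, hv₀⟩ : (earSet W G).Nonempty := Finset.card_pos.1 (by omega)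
  have hx : x ∉ earSet W G := h.notMem_earSet hW4 (hy v₀ hv₀)
  have hxW : x ∈ W := h.mem_right (hy v₀ hv₀).left
  set Y := (earSet W G).image y with hY
  have hYc : Y.card = (earSet W G).card := Finset.card_image_of_injOn hinj
  have hDY : Disjoint (earSet W G) Y := by
    rw [Finset.disjoint_left]
    intro t ht htY
    obtain ⟨v, hv, rfl⟩ := Finset.mem_image.1 htY
    exact hyD v hv ht
  have hDYc := Finset.card_union_of_disjoint hDY
  have hxDY : x ∉ earSet W G ∪ Y := by
    rw [Finset.mem_union, not_or]
    refine ⟨hx, fun hxY => ?_⟩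
    obtain ⟨v, hv, e⟩ := Finset.mem_image.1 hxY
    exact hyx v hv e.symm
  have hadjx : ∀ t ∈ earSet W G ∪ Y, G.Adj x t := by
    intro t ht
    rcases Finset.mem_union.1 ht with ht | ht
    · exact (hy t ht).left.symm
    · obtain ⟨v, hv, rfl⟩ := Finset.mem_image.1 ht
      exact (hy v hv).base
  have hdx : 2 * (earSet W G).card ≤ (nbrs G x).card := by
    have := Finset.card_le_card (s := earSet W G ∪ Y) (t := nbrs G x)
      fun t ht => mem_nbrs.2 (hadjx t ht)
    omega
  set T := insert x (earSet W G ∪ Y) with hT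
  have hTc : T.card = 2 * (earSet W G).card + 1 := by
    rw [hT, Finset.card_insert_of_notMem hxDY]
    omega
  have hTW : T ⊆ W := by
    intro t ht
    rcases Finset.mem_insert.1 ht with rfl | ht
    exacts [hxW, h.mem_right (hadjx t ht)]
  have hrest := Finset.card_sdiff_add_card_eq_card hTW
  have hlow := h.two_mul_edges (S := {x}) (by simpa using hxW)
  have hle := Finset.card_le_card (Finset.sdiff_subset (s := earSet W G) (t := {x}))
  rw [Finset.sum_singleton, Finset.card_singleton] at hlow
  have hcnt := h.two_mul_card_le hW4 (hy v₀ hv₀)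
  have hmemT : ∀ t, t ∈ T ↔ t = x ∨ t ∈ earSet W G ∨ ∃ v ∈ earSet W G, y v = t := by
    intro t
    simp [hT, hY]
  by_contra hlt
  -- With `k` ears and at most `n + 4` edges, the counts read `2k + 1 ≤ n`, `n ≤ k + 5` and `n + k ≤
  -- 11`. So `(k, n)` is `(2, 7)`, `(3, 7)` or `(3, 8)`.
  obtain hk2 | hk3 : (earSet W G).card = 2 ∨ (earSet W G).card = 3 := by omega
  · have h7 : W.card = 7 := by omega
    obtain ⟨a, b, hab, hD⟩ := Finset.card_eq_two.1 hk2
    obtain ⟨u, w, huw, hR⟩ := Finset.card_eq_two.1 (show (W \ T).card = 2 by omega)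
    have ha : a ∈ earSet W G := by simp [hD]
    have hb : b ∈ earSet W G := by simp [hD]
    have hu : u ∈ W \ T := by simp [hR]
    have hw : w ∈ W \ T := by simp [hR]
    rw [Finset.mem_sdiff, hmemT] at hu hw
    obtain ⟨huW, hu⟩ := hu
    obtain ⟨hwW, hw⟩ := hw
    push Not at hu hw
    have hpq : y a ≠ y b := fun e => hab (hinj ha hb e)
    have hpb : y a ≠ b := fun e => hyD a ha (e ▸ hb)
    have hqa : y b ≠ a := fun e => hyD b hb (e ▸ ha)
    have hax : ¬ G.Adj a b := fun hadj => by
      rcases (hy a ha).nbr b hadj with e | e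
      exacts [hx (e ▸ hb), hpb e.symm]
    have deg : ∀ v ∈ earSet W G, ∀ t ∈ W, t ≠ v → t ≠ x → t ≠ y v → (nbrs G t).card ≤ 3 := by
      intro v hv t ht h1 h2 h3
      have h4 := h.sum_compl_ear hW4 (hy v hv) (S := {t}) (by
        rw [Finset.singleton_subset_iff, Finset.mem_sdiff]
        simp [ht, h1, h2, h3])
      have h5 := Finset.card_le_card
        (Finset.sdiff_subset (s := (earSet W G).erase v) (t := {t}))
      rw [Finset.card_erase_of_mem hv] at h5
      rw [Finset.sum_singleton, Finset.card_singleton] at h4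
      omega
    refine h.false_of_two_ears (hy a ha) (hy b hb) hab hax hpb hqa hpq hu.1
      (hu.2.2 a ha).symm (hu.2.2 b hb).symm ⟨(hw.2.2 a ha).symm, (hw.2.2 b hb).symm⟩
      (w := w) (fun t ht => ?_) ?_ ?_ (h.three_le huW hu.2.1)
    · by_cases htT : t ∈ T
      · rw [hmemT, hD] at htT
        simp only [Finset.mem_insert, Finset.mem_singleton] at htT
        grind
      · have : t ∈ W \ T := Finset.mem_sdiff.2 ⟨ht, htT⟩
        rw [hR] at this
        simp only [Finset.mem_insert, Finset.mem_singleton] at this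
        tauto
    · exact deg b hb _ (h.mem_right (hy a ha).right) hpb (hyx a ha).symm hpq
    · exact deg a ha _ (h.mem_right (hy b hb).right) hqa (hyx b hb).symm hpq.symm
  · obtain ⟨a, b, c, hab, hac, hbc, hD⟩ := Finset.card_eq_three.1 hk3
    have ha : a ∈ earSet W G := by simp [hD]
    have hb : b ∈ earSet W G := by simp [hD]
    have hc : c ∈ earSet W G := by simp [hD]
    have epq : y a ≠ y b := fun e => hab (hinj ha hb e)
    have epr : y a ≠ y c := fun e => hac (hinj ha hc e)
    have eqr : y b ≠ y c := fun e => hbc (hinj hb hc e)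
    by_cases h7 : W.card = 7
    · have hWT : W \ T = ∅ := Finset.card_eq_zero.1 (by omega)
      have hall : ∀ t ∈ W, t = x ∨ t = a ∨ t = b ∨ t = c ∨ t = y a ∨ t = y b ∨ t = y c := by
        intro t ht
        have htT : t ∈ T := Finset.sdiff_eq_empty_iff_subset.1 hWT ht
        rw [hmemT, hD] at htT
        simp only [Finset.mem_insert, Finset.mem_singleton] at htT
        grind
      -- The three outer base vertices are pairwise adjacent, hence of degree at least four; with
      -- degree at least six at `x` this gives 12 edges.
      have pq := h.star_adj hy ha hb hc hab hx hyD epq epr eqr hall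
      have pr := h.star_adj hy ha hc hb hac hx hyD epr epq eqr.symm
        fun t ht => by have := hall t ht; tauto
      have qr := h.star_adj hy hb hc ha hbc hx hyD eqr epq.symm epr.symm
        fun t ht => by have := hall t ht; tauto
      have four : ∀ v ∈ earSet W G, ∀ s t, G.Adj (y v) s → G.Adj (y v) t → s ≠ t →
          s ∉ earSet W G → t ∉ earSet W G → s ≠ x → t ≠ x → 4 ≤ (nbrs G (y v)).card := by
        intro v hv s t hs ht hst hsD htD hsx htx
        have h1 : ({x, v, s, t} : Finset V).card = 4 := by
          rw [Finset.card_insert_of_notMem, Finset.card_insert_of_notMem,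
            Finset.card_pair hst] <;> simp only [Finset.mem_insert, Finset.mem_singleton, not_or]
          · exact ⟨fun e => hsD (e ▸ hv), fun e => htD (e ▸ hv)⟩
          · exact ⟨(hy v hv).left.ne', hsx.symm, htx.symm⟩
        rw [← h1]
        refine Finset.card_le_card fun r hr => ?_
        simp only [Finset.mem_insert, Finset.mem_singleton] at hr
        rw [mem_nbrs]
        rcases hr with rfl | rfl | rfl | rfl
        exacts [(hy v hv).base.symm, (hy _ hv).right.symm, hs, ht]
      have ga := four a ha _ _ pq pr eqr (hyD b hb) (hyD c hc) (hyx b hb).symm (hyx c hc).symm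
      have gb := four b hb _ _ pq.symm qr epr (hyD a ha) (hyD c hc) (hyx a ha).symm (hyx c hc).symm
      have gc := four c hc _ _ pr.symm qr.symm epq (hyD a ha) (hyD b hb) (hyx a ha).symm
        (hyx b hb).symm
      have hS : ({x, y a, y b, y c} : Finset V) ⊆ W := by
        intro t ht
        simp only [Finset.mem_insert, Finset.mem_singleton] at ht
        rcases ht with rfl | rfl | rfl | rfl
        exacts [hxW, h.mem_right (hy a ha).right, h.mem_right (hy b hb).right,
          h.mem_right (hy c hc).right]
      have h1 := h.two_mul_edges hS
      have h2 := Finset.card_le_card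
        (Finset.sdiff_subset (s := earSet W G) (t := {x, y a, y b, y c}))
      have hxn : x ∉ ({y a, y b, y c} : Finset V) := by simp [hyx a ha, hyx b hb, hyx c hc]
      have han : y a ∉ ({y b, y c} : Finset V) := by simp [epq, epr]
      rw [Finset.sum_insert hxn, Finset.sum_insert han, Finset.sum_pair eqr,
        Finset.card_insert_of_notMem hxn, Finset.card_insert_of_notMem han,
        Finset.card_pair eqr] at h1
      omega
    -- The count is tight again: `x` is not joined to the last vertex `u`, whose neighbours are
    -- exactly the `y v`, and each `y v` has only the neighbours `x`, `v`, `u`. After joining `x` to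
    -- `u`, the second core would have to lie in the matching of the pairs `v`, `y v`.
    · have h8 : W.card = 8 := by omega
      obtain ⟨u, hR⟩ := Finset.card_eq_one.1 (show (W \ T).card = 1 by omega)
      have hu : u ∈ W \ T := by simp [hR]
      rw [Finset.mem_sdiff, hmemT] at hu
      obtain ⟨huW, hu⟩ := hu
      push Not at hu
      have hux : ¬ G.Adj x u := fun hadj => by
        have := nbrs_subset_of_card hadjx hDYc (by omega) u hadj
        rw [Finset.mem_union] at this
        rcases this with h1 | h1
        · exact hu.2.1 h1
        · obtain ⟨v, hv, e⟩ := Finset.mem_image.1 h1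
          exact hu.2.2 v hv e
      have hun : ∀ t, G.Adj u t → t ∈ Y := by
        intro t ht
        by_cases htT : t ∈ T
        · rw [hmemT] at htT
          rcases htT with rfl | htD | ⟨v, hv, rfl⟩
          · exact absurd ht.symm hux
          · exact absurd ((hy t htD).nbr u ht.symm) (by
              rintro (e | e)
              exacts [hu.1 e, hu.2.2 t htD e.symm])
          · exact Finset.mem_image_of_mem y hv
        · have : t ∈ W \ T := Finset.mem_sdiff.2 ⟨h.mem_right ht, htT⟩
          rw [hR, Finset.mem_singleton] at this
          exact absurd this ht.ne'
      have hu3 := h.three_le huW hu.2.1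
      have huY : nbrs G u = Y :=
        Finset.eq_of_subset_of_card_le (fun t ht => hun t (mem_nbrs.1 ht)) (by omega)
      have hyn : ∀ v ∈ earSet W G, ∀ t, G.Adj (y v) t → t = x ∨ t = v ∨ t = u := by
        intro v hv t ht
        have hvu : v ≠ u := fun e => hu.2.1 (e ▸ hv)
        have h1 : (nbrs G (y v)).card ≤ 3 := by
          have h2 := h.two_mul_edges (S := {x, y v}) (by
            intro s hs
            simp only [Finset.mem_insert, Finset.mem_singleton] at hs
            rcases hs with rfl | rfl
            exacts [hxW, h.mem_right (hy v hv).right])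
          have h3 := Finset.card_le_card
            (Finset.sdiff_subset (s := earSet W G) (t := {x, y v}))
          rw [Finset.sum_pair (hyx v hv), Finset.card_pair (hyx v hv)] at h2
          omega
        have h4 := nbrs_subset_of_card (v := y v) (S := {x, v, u}) (fun s hs => by
          simp only [Finset.mem_insert, Finset.mem_singleton] at hs
          rcases hs with rfl | rfl | rfl
          · exact (hy v hv).base.symm
          · exact (hy _ hv).right.symm
          · exact (mem_nbrs.1 (huY ▸ Finset.mem_image_of_mem y hv)).symm)
          (Finset.card_eq_three.2 ⟨x, v, u, (hy v hv).left.ne', Ne.symm hu.1, hvu, rfl⟩) h1 t ht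
        simpa using h4
      obtain ⟨A, B, hAB, hxA, huA, hA, hB, hAW, hBW⟩ := h.exists_cores hxW huW (Ne.symm hu.1) hux
      have hd := Finset.disjoint_left.1 hAB
      obtain ⟨t, ht⟩ := hB.1
      have hDB : ∀ v ∈ earSet W G, v ∉ B := fun v hv hvB =>
        hd hxA (hB.mem_of_two hvB (hy v hv).nbr).1
      have hYB : ∀ v ∈ earSet W G, y v ∉ B := fun v hv hvB => by
        obtain ⟨r, hr, s, hs, hrs, h1, h2⟩ := hB.2 _ hvB
        have h3 : ∀ s ∈ B, G.Adj (y v) s → s = v := fun s hs h4 =>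
          (hyn v hv s h4).elim (fun e => (hd hxA (e ▸ hs)).elim)
            fun e => e.elim id fun e => (hd huA (e ▸ hs)).elim
        exact hrs ((h3 r hr h1).trans (h3 s hs h2).symm)
      by_cases htT : t ∈ T
      · rw [hmemT] at htT
        rcases htT with rfl | htD | ⟨v, hv, rfl⟩
        exacts [hd hxA ht, hDB t htD ht, hYB v hv ht]
      · have : t ∈ W \ T := Finset.mem_sdiff.2 ⟨hBW ht, htT⟩
        rw [hR, Finset.mem_singleton] at this
        exact hd huA (this ▸ ht)

/-- The bases are distinct and pairwise intersecting pairs, so they share a common vertex or are the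
sides of a triangle. -/
theorem edges_ge (h : ReducedOn W G) (hW : 7 ≤ W.card) : W.card + 5 ≤ (edges G).card := by
  have hW4 : 4 ≤ W.card := by omega
  by_cases h0 : earSet W G = ∅
  · exact h.edges_ge_of_earSet_eq_empty h0 hW
  obtain ⟨a, ha⟩ := Finset.nonempty_iff_ne_empty.2 h0
  obtain ⟨p, q, ea⟩ := h.exists_ear a (mem_earSet.1 ha).1 (mem_earSet.1 ha).2
  by_cases hk : (earSet W G).card ≤ 1
  · have := h.two_mul_card_le hW4 ea
    omega
  obtain ⟨b, hb, hba⟩ := Finset.exists_mem_ne (s := earSet W G) (by omega) a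
  obtain ⟨r, s, eb⟩ := h.exists_ear b (mem_earSet.1 hb).1 (mem_earSet.1 hb).2
  obtain ⟨x, y, z, ea, eb⟩ : ∃ x y z, IsEar G a x y ∧ IsEar G b x z := by
    rcases h.ear_inter hW4 ea eb hba.symm with rfl | rfl | rfl | rfl
    exacts [⟨p, q, s, ea, eb⟩, ⟨p, q, r, ea, eb.swap⟩, ⟨q, p, s, ea.swap, eb⟩,
      ⟨q, p, r, ea.swap, eb.swap⟩]
  by_cases hstar : ∀ v ∈ earSet W G, ∃ t, IsEar G v x t
  · choose! f hf using hstar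
    exact h.edges_ge_of_star hW hf (by omega)
  push Not at hstar
  obtain ⟨c, hc, hcx⟩ := hstar
  obtain ⟨p, q, ec⟩ := h.exists_ear c (mem_earSet.1 hc).1 (mem_earSet.1 hc).2
  have i1 := h.ear_inter hW4 ec ea (by rintro rfl; exact hcx _ ea)
  have i2 := h.ear_inter hW4 ec eb (by rintro rfl; exact hcx _ eb)
  have hpx : p ≠ x := by rintro rfl; exact hcx _ ec
  have hqx : q ≠ x := by rintro rfl; exact hcx _ ec.swap
  have hyz : y ≠ z := by rintro rfl; exact hba (h.twin _ _ _ _ eb ea)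
  have hpq : (p = y ∧ q = z) ∨ (p = z ∧ q = y) := by
    have := ec.base.ne
    grind
  rcases hpq with ⟨rfl, rfl⟩ | ⟨rfl, rfl⟩
  · exact h.edges_ge_of_triangle_ears hW ec eb ea
  · exact h.edges_ge_of_triangle_ears hW ec.swap eb ea

end ReducedOn

/-! ### Induction on the number of vertices -/

namespace SatOn

/-- A leaf deletion or suppression loses one vertex and one edge, so the bound carries over and the
hub alternative is contradictory. Deleting a twin loses two edges, so even the weaker bound for the
smaller graph suffices. -/
theorem edges_ge_of_smaller (h : SatOn W G) (hW : 7 ≤ W.card)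
    (ih : ∀ (W' : Finset V) (G' : SimpleGraph V), SatOn W' G' → W'.card + 1 = W.card →
      W'.card + 5 ≤ (edges G').card ∨ W'.card + 4 ≤ (edges G').card ∧ HasHub W' G') :
    W.card + 5 ≤ (edges G).card := by
  by_contra hlt
  refine hlt (ReducedOn.edges_ge ⟨h, fun v hv => ?_, fun v hv hv2 => ?_, fun v w x y ev ew => ?_⟩ hW)
  · by_contra hv2
    obtain ⟨q, hq⟩ := h.exists_adj hv (by omega)
    have hv1 : nbrs G v = {q} :=
      (Finset.eq_of_subset_of_card_le (by simpa using hq) (by rw [Finset.card_singleton]; omega)).symm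
    have hn : ∀ w, G.Adj v w → w = q := fun w hw => by
      rw [← mem_nbrs, hv1] at hw
      simpa using hw
    have hc := Finset.card_erase_add_one hv
    have he := card_edges_deleteIncidenceSet (G := G) v
    rw [hv1, Finset.card_singleton] at he
    rcases ih _ _ (h.delete_leaf hn) hc with h1 | ⟨-, h1⟩
    · omega
    · exact h.false_of_leaf hq hn (by omega) h1
  · obtain ⟨x, y, hxy, hxyv⟩ := Finset.card_eq_two.1 hv2
    have hx : G.Adj v x := mem_nbrs.1 (by simp [hxyv])
    have hy : G.Adj v y := mem_nbrs.1 (by simp [hxyv])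
    have hn : ∀ w, G.Adj v w → w = x ∨ w = y := fun w hw => by
      rw [← mem_nbrs, hxyv] at hw
      simpa using hw
    refine ⟨x, y, hx, hy, ?_, hn⟩
    by_contra hadj
    have hc := Finset.card_erase_add_one hv
    have he := card_edges_deleteIncidenceSet (G := G) v
    have he' := card_edges_sup_edge (G := G.deleteIncidenceSet v)
      (fun hxy' => hadj (deleteIncidenceSet_adj.1 hxy').1) hxy
    rcases ih _ _ (h.suppress hx hy hxy hn hadj) hc with h1 | ⟨-, h1⟩
    · omega
    · exact h.false_of_suppress hx hy hxy hn hadj h1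
  · by_contra hvw
    have hc := Finset.card_erase_add_one (h.mem_left ev.left)
    have he := card_edges_deleteIncidenceSet (G := G) v
    rw [ev.card_nbrs] at he
    have := ih _ _ (h.delete_twin hvw ew.left ew.right ev.nbr ew.nbr ev.base) hc
    omega

theorem edges_ge_or (n : ℕ) : ∀ (W : Finset V) (G : SimpleGraph V), SatOn W G → W.card = n + 6 →
    W.card + 5 ≤ (edges G).card ∨ W.card + 4 ≤ (edges G).card ∧ HasHub W G := by
  induction n with
  | zero =>
    intro W G h hW
    refine (h.six_le hW).imp (fun h1 => by omega) fun ⟨h1, h2⟩ => ⟨by omega, ?_⟩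
    exact h2.hasHub hW h.supp
  | succ n ih =>
    intro W G h hW
    exact Or.inl (h.edges_ge_of_smaller (by omega) fun W' G' h' hW' => ih W' G' h' (by omega))

theorem edges_ge (h : SatOn W G) (hW : 7 ≤ W.card) : W.card + 5 ≤ (edges G).card :=
  h.edges_ge_of_smaller hW fun W' G' h' hW' => edges_ge_or (W'.card - 6) W' G' h' (by omega)

end SatOn

end Final

/-! ### The wheel is saturated -/

theorem HasHub.not_hasTwoCores {V : Type} [DecidableEq V] {G : SimpleGraph V} {W : Finset V}
    (h : HasHub W G) (hs : ∀ u v, G.Adj u v → u ∈ W) :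
    ¬ HasTwoCores G := by
  obtain ⟨c, -, hub⟩ := h
  have key : ∀ A B, Disjoint A B → IsCore G A → IsCore G B → c ∈ A := by
    intro A B hAB hA hB
    by_contra hc
    have hsub : B ⊆ {c, c} := fun t ht => by
      by_contra htc
      simp only [Finset.mem_insert, Finset.mem_singleton, or_self] at htc
      obtain ⟨s, -, -, -, -, hts, -⟩ := hB.2 t ht
      exact Finset.disjoint_left.1 hAB (hub A hA hc t (hs _ _ hts) htc) ht
    exact hB.not_subset_pair hsub
  rintro ⟨A, B, hAB, hA, hB⟩
  exact Finset.disjoint_left.1 hAB (key A B hAB hA hB) (key B A hAB.symm hB hA)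

/-- Non-adjacent vertices are rim vertices at distance two: their common rim neighbour `k` closes a
triangle on the new edge, and the other two rim vertices form one with the hub. -/
theorem wheelAdj_saturated : ∀ i j : Fin 6, i ≠ j → wheelAdj i j = false →
    ∃ k p q : Fin 6, wheelAdj i k = true ∧ wheelAdj k j = true ∧ wheelAdj 5 p = true ∧
      wheelAdj p q = true ∧ wheelAdj 5 q = true ∧ (i ≠ 5 ∧ i ≠ p ∧ i ≠ q) ∧
      (k ≠ 5 ∧ k ≠ p ∧ k ≠ q) ∧ j ≠ 5 ∧ j ≠ p ∧ j ≠ q := by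
  decide +kernel

theorem IsWheelOn.satOn {V : Type} [DecidableEq V] {G : SimpleGraph V} {W : Finset V}
    (h : IsWheelOn W G) (hc : W.card = 6)
    (hs : ∀ u v, G.Adj u v → u ∈ W) : SatOn W G := by
  refine ⟨hs, (h.hasHub hc hs).not_hasTwoCores hs, ?_⟩
  obtain ⟨g, hg, hgW, hadj⟩ := h
  intro u hu v hv huv huv'
  obtain ⟨i, rfl⟩ := exists_label_of_card hg hgW hc hu
  obtain ⟨j, rfl⟩ := exists_label_of_card hg hgW hc hv
  obtain ⟨k, p, q, h1, h2, h3, h4, h5, ⟨i1, i2, i3⟩, ⟨k1, k2, k3⟩, j1, j2, j3⟩ :=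
    wheelAdj_saturated i j (fun e => huv (by rw [e]))
      (by rw [Bool.eq_false_iff, ne_eq, ← hadj]; exact huv')
  rw [← hadj] at h1 h2 h3 h4 h5
  by_contra hcon
  have hle : ∀ {a b}, G.Adj a b → (G ⊔ edge (g i) (g j)).Adj a b := fun h => Or.inl h
  exact not_triangles hcon (hle h1) (hle h2)
    (sup_edge_adj_iff.2 (Or.inr ⟨huv, Or.inl ⟨rfl, rfl⟩⟩)) (hle h3) (hle h4) (hle h5)
    (hg.ne i1) (hg.ne i2) (hg.ne i3) (hg.ne k1) (hg.ne k2) (hg.ne k3) (hg.ne j1) (hg.ne j2)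
    (hg.ne j3)

section Wheel
variable {V : Type} [Fintype V] {G : SimpleGraph V} {W : Finset V}

theorem isSaturated_iff_satOn : IsSaturated twoDisjointCycles G ↔ SatOn Finset.univ G := by
  rw [isSaturated_twoDisjointCycles_iff]
  exact ⟨fun h => ⟨fun _ _ _ => Finset.mem_univ _, h.1, fun u _ v _ => h.2 u v⟩,
    fun h => ⟨h.free, fun u v => h.sat u (Finset.mem_univ _) v (Finset.mem_univ _)⟩⟩

theorem IsWheelOn.card_edges [DecidableEq V] (h : IsWheelOn W G) (hc : W.card = 6)
    (hs : ∀ u v, G.Adj u v → u ∈ W) : (edges G).card = 10 := by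
  have hsat := h.satOn hc hs
  obtain ⟨g, hg, hgW, hadj⟩ := h
  rw [hsat.card_edges_eq_countPairs hc hg hgW hadj]
  decide

/-- The labelling of the vertices of the wheel used by `wheelAdj`. -/
def wheelLabel : Fin 6 → Fin 1 ⊕ Fin (6 - 1) :=
  ![Sum.inr 0, Sum.inr 1, Sum.inr 2, Sum.inr 3, Sum.inr 4, Sum.inl 0]

theorem wheelLabel_bijective : Function.Bijective wheelLabel := by
  rw [Fintype.bijective_iff_injective_and_card]
  exact ⟨by decide, rfl⟩

theorem wheelGraph_adj_wheelLabel (i j : Fin 6) :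
    (wheelGraph 6).Adj (wheelLabel i) (wheelLabel j) ↔ wheelAdj i j = true := by
  fin_cases i <;> fin_cases j <;>
    simp [wheelGraph, wheelLabel, wheelAdj, cycleGraph_adj, completeBipartiteGraph] <;> decide

theorem isWheelOn_univ_iff {G : SimpleGraph (Fin 6)} :
    IsWheelOn Finset.univ G ↔ Nonempty (G ≃g wheelGraph 6) := by
  let σ := Equiv.ofBijective wheelLabel wheelLabel_bijective
  constructor
  · rintro ⟨g, hg, -, hadj⟩
    let τ := Equiv.ofBijective g (Finite.injective_iff_bijective.1 hg)
    refine ⟨⟨τ.symm.trans σ, fun {a b} => ?_⟩⟩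
    obtain ⟨i, rfl⟩ := τ.surjective a
    obtain ⟨j, rfl⟩ := τ.surjective b
    rw [Equiv.trans_apply, Equiv.trans_apply, Equiv.symm_apply_apply, Equiv.symm_apply_apply]
    exact (wheelGraph_adj_wheelLabel i j).trans (hadj i j).symm
  · rintro ⟨φ⟩
    refine ⟨fun i => φ.symm (wheelLabel i), φ.symm.injective.comp wheelLabel_bijective.1,
      fun _ => Finset.mem_univ _, fun i j => ?_⟩
    rw [φ.symm.map_adj_iff, wheelGraph_adj_wheelLabel]

end Wheel

/-! ### The upper bound -/

section UpperBound

/-- The complete graph on the first five vertices, with all other vertices attached to `0`. -/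
def pendantK5 (n : ℕ) : SimpleGraph (Fin n) where
  Adj i j := i ≠ j ∧ (i.val = 0 ∨ j.val = 0 ∨ i.val < 5 ∧ j.val < 5)
  symm := ⟨fun i j h => ⟨h.1.symm, by tauto⟩⟩
  loopless := ⟨fun i h => h.1 rfl⟩

theorem satOn_pendantK5 {n : ℕ} (hn : 6 ≤ n) : SatOn Finset.univ (pendantK5 n) := by
  have hadj : ∀ i j, (pendantK5 n).Adj i j ↔
      i ≠ j ∧ (i.val = 0 ∨ j.val = 0 ∨ i.val < 5 ∧ j.val < 5) := fun _ _ => Iff.rfl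
  refine ⟨fun _ _ _ => Finset.mem_univ _, ?_, fun u _ v _ huv huv' => ?_⟩
  · rintro ⟨A, B, hAB, hA, hB⟩
    -- Pendant vertices lie in no core, and two disjoint cores need six vertices while only five are
    -- left.
    have hlt : ∀ A, IsCore (pendantK5 n) A → ∀ i ∈ A, i.val < 5 := by
      intro A hA i hi
      by_contra h5
      refine hA.notMem_of_one (q := ⟨0, by omega⟩) (fun w hw => ?_) hi
      rw [hadj] at hw
      ext
      simp only
      omega
    have h1 := Finset.card_union_of_disjoint hAB
    have h2 : (A ∪ B).card ≤ (Finset.range 5).card := by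
      refine Finset.card_le_card_of_injOn Fin.val (fun i hi => ?_) Fin.val_injective.injOn
      rw [Finset.mem_coe, Finset.mem_union] at hi
      simpa using hi.elim (hlt A hA i) (hlt B hB i)
    have h3 := hA.three_le_card
    have h4 := hB.three_le_card
    rw [Finset.card_range] at h2
    omega
  · rw [hadj] at huv'
    have huv2 : u.val ≠ v.val := fun e => huv (Fin.ext e)
    -- One of `u`, `v` is pendant, so three of the vertices `1, 2, 3, 4` avoid both; they form a
    -- triangle disjoint from the new triangle `u, 0, v`.
    obtain ⟨a, b, c, ha, hab, hbc, hc, hau, hbu, hcu, hav, hbv, hcv⟩ : ∃ a b c : ℕ, 1 ≤ a ∧ a < b ∧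
        b < c ∧ c ≤ 4 ∧ a ≠ u ∧ b ≠ u ∧ c ≠ u ∧ a ≠ v ∧ b ≠ v ∧ c ≠ v := by
      by_cases h1 : u.val = 1 ∨ v.val = 1
      · exact ⟨2, 3, 4, by omega⟩
      by_cases h2 : u.val = 2 ∨ v.val = 2
      · exact ⟨1, 3, 4, by omega⟩
      by_cases h3 : u.val = 3 ∨ v.val = 3
      · exact ⟨1, 2, 4, by omega⟩
      · exact ⟨1, 2, 3, by omega⟩
    by_contra hcon
    have hle : ∀ {i j}, (pendantK5 n).Adj i j → (pendantK5 n ⊔ edge u v).Adj i j :=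
      fun h => Or.inl h
    refine not_triangles hcon (x := u) (y := ⟨0, by omega⟩) (z := v) (a := ⟨a, by omega⟩)
      (b := ⟨b, by omega⟩) (c := ⟨c, by omega⟩) (hle ?_) (hle ?_)
      (sup_edge_adj_iff.2 (Or.inr ⟨huv, Or.inl ⟨rfl, rfl⟩⟩)) (hle ?_) (hle ?_) (hle ?_)
      ?_ ?_ ?_ ?_ ?_ ?_ ?_ ?_ ?_ <;> simp [hadj, Fin.ext_iff] <;> omega

/-- There are `n - 1` edges at `0` and six among `1, 2, 3, 4`. Only this inequality is needed, as
the general lower bound gives equality for `n ≥ 7`. -/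
theorem card_edges_pendantK5_le {n : ℕ} (hn : 6 ≤ n) : (edges (pendantK5 n)).card ≤ n + 5 := by
  let f : ℕ → Fin n := fun i => if h : i < n then ⟨i, h⟩ else ⟨0, by omega⟩
  have hf : ∀ i : Fin n, f i.val = i := fun i => by simp [f]
  let P : Finset (ℕ × ℕ) := (Finset.range 5 ×ˢ Finset.range 5).filter fun p => 1 ≤ p.1 ∧ p.1 < p.2
  let E : Finset (Sym2 (Fin n)) := P.image fun p => s(f p.1, f p.2)
  have hE : E.card ≤ 6 := Finset.card_image_le.trans (by decide)
  have hEmem : ∀ i j : Fin n, 1 ≤ i.val → i.val < j.val → j.val < 5 → s(i, j) ∈ E := by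
    intro i j h1 h2 h3
    refine Finset.mem_image.2 ⟨(i.val, j.val), ?_, by simp only [hf]⟩
    simp only [P, Finset.mem_filter, Finset.mem_product, Finset.mem_range]
    omega
  have hsub : edges (pendantK5 n) ⊆ (Finset.univ.erase (f 0)).image (fun i => s(f 0, i)) ∪ E := by
    intro e he
    rw [mem_edges] at he
    induction e using Sym2.ind with
    | _ i j =>
      obtain ⟨hij, h⟩ : i ≠ j ∧ (i.val = 0 ∨ j.val = 0 ∨ i.val < 5 ∧ j.val < 5) := he
      rw [Finset.mem_union, Finset.mem_image]
      by_cases hi : i.val = 0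
      · left
        have h0 : f 0 = i := by rw [← hi, hf]
        exact ⟨j, by simp [h0, hij.symm], by rw [h0]⟩
      by_cases hj : j.val = 0
      · left
        have h0 : f 0 = j := by rw [← hj, hf]
        exact ⟨i, by simp [h0, hij], by rw [h0, Sym2.eq_swap]⟩
      · right
        have hij' : i.val ≠ j.val := fun e => hij (Fin.ext e)
        rcases Nat.lt_or_gt_of_ne hij' with h1 | h1
        · exact hEmem i j (by omega) h1 (by omega)
        · rw [Sym2.eq_swap]
          exact hEmem j i (by omega) h1 (by omega)
  have h1 := (Finset.card_le_card hsub).trans (Finset.card_union_le _ _)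
  have h2 := Finset.card_image_le (s := Finset.univ.erase (f 0)) (f := fun i => s(f 0, i))
  rw [Finset.card_erase_of_mem (Finset.mem_univ _), Finset.card_univ, Fintype.card_fin] at h2
  omega

end UpperBound

/-! ### The saturation numbers and the extremal graph -/

theorem exists_isWheelOn : ∃ G : SimpleGraph (Fin 6), IsWheelOn Finset.univ G := by
  let σ := Equiv.ofBijective wheelLabel wheelLabel_bijective
  exact ⟨(wheelGraph 6).comap σ, isWheelOn_univ_iff.2 ⟨Iso.comap σ _⟩⟩

theorem mem_saturationSpectrum {n m : ℕ} : m ∈ saturationSpectrum n twoDisjointCycles ↔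
    ∃ G : SimpleGraph (Fin n), SatOn Finset.univ G ∧ (edges G).card = m := by
  simp only [saturationSpectrum, Set.mem_ofPred_eq, isSaturated_iff_satOn, card_edges_eq_ncard]

theorem isLeast_saturationSpectrum_six : IsLeast (saturationSpectrum 6 twoDisjointCycles) 10 := by
  constructor
  · obtain ⟨G, hG⟩ := exists_isWheelOn
    exact mem_saturationSpectrum.2 ⟨G, hG.satOn (by simp) (by simp), hG.card_edges (by simp) (by simp)⟩
  · intro m hm
    obtain ⟨G, hG, rfl⟩ := mem_saturationSpectrum.1 hm
    rcases hG.six_le (by simp) with h | ⟨h, -⟩ <;> omega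

theorem isLeast_saturationSpectrum {n : ℕ} (hn : 7 ≤ n) :
    IsLeast (saturationSpectrum n twoDisjointCycles) (n + 5) := by
  have lower : ∀ G : SimpleGraph (Fin n), SatOn Finset.univ G → n + 5 ≤ (edges G).card := by
    intro G hG
    simpa using hG.edges_ge (by simpa using hn)
  constructor
  · have h := satOn_pendantK5 (n := n) (by omega)
    exact mem_saturationSpectrum.2 ⟨_, h,
      le_antisymm (card_edges_pendantK5_le (by omega)) (lower _ h)⟩
  · intro m hm
    obtain ⟨G, hG, rfl⟩ := mem_saturationSpectrum.1 hm
    exact lower G hG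

theorem mainTheorem1 :
    (∀ n : ℕ, 6 ≤ n →
      (saturationSpectrum n twoDisjointCycles).Nonempty ∧
        satNumber n twoDisjointCycles = if n = 6 then 10 else n + 5) ∧
    (∀ G : SimpleGraph (Fin 6),
      (IsSaturated twoDisjointCycles G ∧
          G.edgeSet.ncard = satNumber 6 twoDisjointCycles) ↔
        Nonempty (G ≃g wheelGraph 6)) := by
  refine ⟨fun n hn => ?_, fun G => ?_⟩
  · split_ifs with h6
    · subst h6
      exact ⟨isLeast_saturationSpectrum_six.nonempty, isLeast_saturationSpectrum_six.csInf_eq⟩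
    · have h := isLeast_saturationSpectrum (n := n) (by omega)
      exact ⟨h.nonempty, h.csInf_eq⟩
  · have h6 : satNumber 6 twoDisjointCycles = 10 := isLeast_saturationSpectrum_six.csInf_eq
    rw [h6, isSaturated_iff_satOn, ← isWheelOn_univ_iff, ← card_edges_eq_ncard]
    constructor
    · rintro ⟨h, h10⟩
      rcases h.six_le (by simp) with h1 | ⟨-, h1⟩
      · omega
      · exact h1
    · intro h
      exact ⟨h.satOn (by simp) (by simp), h.card_edges (by simp) (by simp)⟩
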